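/- \textbf{Theorem} ($R_\varepsilon$). There is a universal constant $C>0$ with the following property. Let $\mathcal H$ be a separable (real or complex) Hilbert space and let $\{u_i\}_{i\in I}$ be a family of unit vectors in $\mathcal H$ that is a Bessel sequence with bound $B>0$, that is, $$\sum_{i\in I}|\langle u,u_i\rangle|^2\le B\|u\|^2\qquad\text{for all }u\in\mathcal H.$$ Then for every $0<\varepsilon<1$ there exist an integer $r\le C\,B/\varepsilon^{4}$ and a partition $\{I_1,\dots,I_r\}$ of $I$ into nonempty sets such that each subfamily $\{u_i\}_{i\in I_j}$, $j=1,\dots,r$, is a Riesz sequence with bounds $1-\varepsilon$ and $1+\varepsilon$; that is, for every family of scalars $\{a_i\}\in\ell^2(I_j)$ the series $\sum_{i\in I_j}a_iu_i$ converges unconditionally in $\mathcal H$ and $$(1-\varepsilon)\sum_{i\in I_j}|a_i|^2\le\Big\|\sum_{i\in I_j}a_iu_i\Big\|^2\le(1+\varepsilon)\sum_{i\in I_j}|a_i|^2 .$$ (If $I=\emptyset$, then $r=0$.) -/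

import Mathlib

/-- The family `u` is a Bessel sequence with bound `B > 0`:
`∑ |⟪x, u i⟫|² ≤ B ‖x‖²` for every vector `x` (convergence of the series included). -/
def IsBesselSeq (𝕜 : Type*) [RCLike 𝕜] {H : Type*} [NormedAddCommGroup H]
    [InnerProductSpace 𝕜 H] {ι : Type*} (u : ι → H) (B : ℝ) : Prop :=
  0 < B ∧ ∀ x : H, Summable (fun i => ‖inner 𝕜 x (u i)‖ ^ 2) ∧
    ∑' i, ‖inner 𝕜 x (u i)‖ ^ 2 ≤ B * ‖x‖ ^ 2

/-- The family `u` is a Riesz sequence with lower bound `A > 0` and upper bound `B > 0`: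
for every square-summable family of scalars `a`, the series `∑ a i • u i` converges and
`A ∑ |a i|² ≤ ‖∑ a i • u i‖² ≤ B ∑ |a i|²`. -/
def IsRieszSeq (𝕜 : Type*) [RCLike 𝕜] {H : Type*} [NormedAddCommGroup H]
    [InnerProductSpace 𝕜 H] {ι : Type*} (u : ι → H) (A B : ℝ) : Prop :=
  0 < A ∧ 0 < B ∧ ∀ a : ι → 𝕜, Summable (fun i => ‖a i‖ ^ 2) →
    Summable (fun i => a i • u i) ∧
    A * ∑' i, ‖a i‖ ^ 2 ≤ ‖∑' i, a i • u i‖ ^ 2 ∧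
    ‖∑' i, a i • u i‖ ^ 2 ≤ B * ∑' i, ‖a i‖ ^ 2

/-! A finite colouring can be found on each finite subfamily and passed to the whole family by
compactness (`Finset.rado_selection`), so everything reduces to a finite Gram matrix `G` with unit
diagonal and `0 ≤ G ≤ B`, provided that the number of colours depends only on `B` and `ε`.

The core is one-sided paving, `exists_paving`: a Hermitian `A` with zero diagonal and `-a ≤ A ≤ b`
has an `r`-colouring all of whose blocks are at most `ab/s + 2(s+b)/r`, for any `s > 0`. It is used
twice in `exists_paving_gram`: on `G - 1`, with about `B/ε²` colours, and then on the block-diagonal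
part of `1 - G`, which by then lies between `-ε` and `1`, so that about `1/ε` colours suffice.

One-sided paving uses interlacing polynomials. The mixed determinant sums, over all colourings, the
product of the characteristic polynomials of the blocks. By stability (`mixed_ne_zero`), the indices
can be coloured one at a time without increasing the largest root (`exists_mixedR_addTo_pos`), so it
remains to bound the largest root of the sum. As a polynomial in `z i`, the mixed determinant with
`i` still to be distributed is, up to a factorial, the `(r-1)`-st derivative of the one with `i` in
all `r` sets. Starting from `det(z - A)^r`, each such differentiation allows `z i` to be lowered by
a fixed `δ` while positivity and the barrier bound survive (`barrier_step`,
`mixedR_pos_and_barrier`). The size of `δ` comes from a bound on the diagonal of the resolvent of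
`A` at `b + s` (`normSq_le_of_quad_bounds`), which is where the zero diagonal enters.

Interlacing and barrier both rest on `nonneg_of_im_nonpos_of_splits`: if `g/f` maps the upper
half-plane to the closed lower one, a linear inequality for `g` that is an equality at `f` need only
be checked on the quotients `f/(X - ρ)`. -/

open Polynomial ComplexConjugate

/-! ### Univariate real-rooted polynomials -/

/-- Approach `ρ` along the ray of angle `θ`, divide the imaginary part by `t ^ m`, and let `t → 0`.
The freedom in `θ` later excludes multiple roots. -/
theorem nonneg_mul_sin_of_im_nonpos {f g h : ℝ[X]} {ρ : ℝ} {m : ℕ}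
    (hf : f = (X - C ρ) ^ m * h)
    (him : ∀ w : ℂ, 0 < w.im → (aeval w g * conj (aeval w f)).im ≤ 0)
    {θ : ℝ} (hθ0 : 0 < θ) (hθ1 : θ < Real.pi) :
    0 ≤ g.eval ρ * h.eval ρ * Real.sin (m * θ) := by
  set u : ℂ := Complex.exp (θ * Complex.I) with hu
  set F : ℝ → ℝ := fun t =>
    (aeval ((ρ : ℂ) + t * u) g * conj (aeval ((ρ : ℂ) + t * u) h) * conj (u ^ m)).im with hF
  have hcont : Continuous F := by
    have h1 : ∀ p : ℝ[X], Continuous fun t : ℝ => aeval ((ρ : ℂ) + t * u) p := fun p =>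
      p.continuous_aeval.comp (by fun_prop)
    refine Complex.continuous_im.comp ?_
    exact ((h1 g).mul (Complex.continuous_conj.comp (h1 h))).mul continuous_const
  have hneg : ∀ t : ℝ, 0 < t → F t ≤ 0 := by
    intro t ht
    have hw : 0 < ((ρ : ℂ) + t * u).im := by
      have : ((ρ : ℂ) + t * u).im = t * Real.sin θ := by
        simp [hu, Complex.exp_ofReal_mul_I_im]
      rw [this]
      exact mul_pos ht (Real.sin_pos_of_pos_of_lt_pi hθ0 hθ1)
    have h2 := him _ hw
    rw [hf] at h2
    have h3 : aeval ((ρ : ℂ) + t * u) g * conj (aeval ((ρ : ℂ) + t * u) ((X - C ρ) ^ m * h)) =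
        ((t ^ m : ℝ) : ℂ) * (aeval ((ρ : ℂ) + t * u) g * conj (aeval ((ρ : ℂ) + t * u) h) *
          conj (u ^ m)) := by
      simp [mul_pow]
      ring
    rw [h3, Complex.im_ofReal_mul] at h2
    exact nonpos_of_mul_nonpos_right h2 (by positivity)
  have h0 : F 0 ≤ 0 := by
    refine le_of_tendsto (x := nhdsWithin 0 (Set.Ioi 0)) (hcont.continuousWithinAt.tendsto) ?_
    filter_upwards [self_mem_nhdsWithin] with t ht using hneg t ht
  have h4 : F 0 = -(g.eval ρ * h.eval ρ * Real.sin (m * θ)) := by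
    have e1 : ∀ p : ℝ[X], aeval (ρ : ℂ) p = ((p.eval ρ : ℝ) : ℂ) := fun p => by
      simpa using (aeval_algebraMap_apply ℂ ρ p)
    have e2 : u ^ m = Complex.exp (((m * θ : ℝ) : ℂ) * Complex.I) := by
      rw [hu, ← Complex.exp_nat_mul]; push_cast; ring_nf
    have e3 : (conj (u ^ m)).im = - Real.sin (m * θ) := by
      rw [e2, Complex.conj_im, Complex.exp_ofReal_mul_I_im]
    simp only [hF]
    rw [Complex.ofReal_zero, zero_mul, add_zero, e1, e1, Complex.conj_ofReal, ← Complex.ofReal_mul,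
      Complex.im_ofReal_mul, e3]
    ring
  linarith

/-- A rational function `g / f` with real-rooted denominator mapping the upper half-plane to the
closed lower half-plane is a nonnegative combination of the `1 / (X - ρ)` up to a constant. This is
the dual form of that statement. -/
theorem nonneg_of_im_nonpos_of_splits {f g : ℝ[X]} (hf0 : f ≠ 0) (hf : f.Splits)
    (hdeg : g.natDegree ≤ f.natDegree)
    (him : ∀ w : ℂ, 0 < w.im → (aeval w g * conj (aeval w f)).im ≤ 0)
    (L : ℝ[X] →ₗ[ℝ] ℝ) (hLf : L f = 0) (hL : ∀ ρ h, f = (X - C ρ) * h → 0 ≤ L h) :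
    0 ≤ L g := by
  induction hn : f.natDegree using Nat.strong_induction_on generalizing f g L with
  | _ n ih =>
  -- A common root contributes only the positive factor `|w - ρ|²` to the imaginary part, so it is
  -- cancelled and absorbed into `L`.
  by_cases hcommon : ∃ ρ, f.eval ρ = 0 ∧ g.eval ρ = 0
  · obtain ⟨ρ, h1, h2⟩ := hcommon
    obtain ⟨f₁, rfl⟩ := dvd_iff_isRoot.mpr h1
    obtain ⟨g₁, rfl⟩ := dvd_iff_isRoot.mpr h2
    have hf1 : f₁ ≠ 0 := right_ne_zero_of_mul hf0
    by_cases hg1 : g₁ = 0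
    · simp [hg1]
    have d1 : ((X - C ρ) * f₁).natDegree = f₁.natDegree + 1 := by
      rw [natDegree_mul (X_sub_C_ne_zero ρ) hf1, natDegree_X_sub_C, add_comm]
    have d2 : ((X - C ρ) * g₁).natDegree = g₁.natDegree + 1 := by
      rw [natDegree_mul (X_sub_C_ne_zero ρ) hg1, natDegree_X_sub_C, add_comm]
    have key := ih f₁.natDegree (by omega) hf1 (splits_X_sub_C_mul_iff.mp hf) (g := g₁) (by omega)
      (fun w hw => by
        have := him w hw
        have e : aeval w ((X - C ρ) * g₁) * conj (aeval w ((X - C ρ) * f₁)) =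
            ((Complex.normSq (w - ρ) : ℝ) : ℂ) * (aeval w g₁ * conj (aeval w f₁)) := by
          rw [← Complex.mul_conj]
          simp
          ring
        rw [e, Complex.im_ofReal_mul] at this
        refine nonpos_of_mul_nonpos_right this (Complex.normSq_pos.mpr ?_)
        intro h
        have := congrArg Complex.im h
        simp at this
        linarith)
      (L ∘ₗ LinearMap.mulLeft ℝ (X - C ρ)) (by simpa using hLf)
      (fun σ h e => by
        simp only [LinearMap.comp_apply, LinearMap.mulLeft_apply]
        exact hL σ _ (by rw [e]; ring)) rfl
    simpa using key
  · push Not at hcommon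
    have hloc : ∀ ρ h, f = (X - C ρ) * h → h.eval ρ ≠ 0 ∧ 0 ≤ g.eval ρ * h.eval ρ := by
      intro ρ h e
      have hgρ : g.eval ρ ≠ 0 := hcommon ρ (by simp [e])
      have hh0 : h ≠ 0 := by rintro rfl; simp at e; exact hf0 e
      have hne : h.eval ρ ≠ 0 := by
        intro h0
        obtain ⟨k, hk, hkd⟩ := exists_eq_pow_rootMultiplicity_mul_and_not_dvd h hh0 ρ
        set m := rootMultiplicity ρ h with hm
        have hm1 : 1 ≤ m := (rootMultiplicity_pos hh0).mpr h0
        have hk0 : k.eval ρ ≠ 0 := fun hx => hkd (dvd_iff_isRoot.mpr hx)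
        have hfm : f = (X - C ρ) ^ (m + 1) * k := by
          rw [e, hk, pow_succ]
          ring
        have hpi := Real.pi_pos
        have hmp : (1 : ℝ) ≤ m := by exact_mod_cast hm1
        -- At a root of order `m + 1 ≥ 2`, both angles lie in `(0, π)` and give sines of opposite
        -- sign, forcing `g` or the cofactor `k` to vanish at `ρ`.
        have a1 := nonneg_mul_sin_of_im_nonpos hfm him (θ := Real.pi / (2 * (m + 1)))
          (by positivity) (by rw [div_lt_iff₀ (by positivity)]; nlinarith)
        have a2 := nonneg_mul_sin_of_im_nonpos hfm him (θ := 3 * Real.pi / (2 * (m + 1)))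
          (by positivity) (by rw [div_lt_iff₀ (by positivity)]; nlinarith)
        have t1 : ((m + 1 : ℕ) : ℝ) * (Real.pi / (2 * (m + 1))) = Real.pi / 2 := by
          push_cast; field_simp
        have t2 : ((m + 1 : ℕ) : ℝ) * (3 * Real.pi / (2 * (m + 1))) = Real.pi / 2 + Real.pi := by
          push_cast; field_simp; ring
        rw [t1, Real.sin_pi_div_two] at a1
        rw [t2, Real.sin_add_pi, Real.sin_pi_div_two] at a2
        have : g.eval ρ * k.eval ρ = 0 := by linarith
        exact (mul_ne_zero hgρ hk0) this
      refine ⟨hne, ?_⟩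
      have a1 := nonneg_mul_sin_of_im_nonpos (m := 1) (by simpa using e) him (θ := Real.pi / 2)
        (by positivity) (by linarith [Real.pi_pos])
      simpa using a1
    set q : ℝ → ℝ[X] := fun ρ => f /ₘ (X - C ρ) with hq
    have hqe : ∀ ρ ∈ f.roots, f = (X - C ρ) * q ρ := fun ρ hρ =>
      (mul_divByMonic_eq_iff_isRoot.mpr (isRoot_of_mem_roots hρ)).symm
    have hnodup : f.roots.Nodup := by
      rw [Multiset.nodup_iff_count_le_one]
      intro ρ
      rw [count_roots]
      by_contra hc
      push Not at hc
      have hd : (X - C ρ) ^ 2 ∣ f := (le_rootMultiplicity_iff hf0).mp (by omega)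
      obtain ⟨k, hk⟩ := hd
      refine (hloc ρ ((X - C ρ) * k) (by rw [hk]; ring)).1 (by simp)
    have hcard : f.roots.toFinset.card = n := by
      rw [Multiset.toFinset_card_of_nodup hnodup, ← hf.natDegree_eq_card_roots, hn]
    set κ : ℝ := g.coeff n / f.coeff n with hκ
    have hlead : f.coeff n ≠ 0 := by rw [← hn]; exact leadingCoeff_ne_zero.mpr hf0
    -- Partial fractions of `g / f`, cleared of denominators: Lagrange interpolation at the simple
    -- roots, with `q ρ` equal to `f / (X - ρ)`.
    have hrep : g - C κ * f = ∑ ρ ∈ f.roots.toFinset, C (g.eval ρ / (q ρ).eval ρ) * q ρ := by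
      refine Polynomial.eq_of_degrees_lt_of_eval_finset_eq f.roots.toFinset ?_ ?_ ?_
      · rw [hcard, degree_lt_iff_coeff_zero]
        intro k hk
        rcases hk.eq_or_lt with rfl | hk
        · simp [hκ, hlead]
        · simp [coeff_eq_zero_of_natDegree_lt (lt_of_le_of_lt hdeg (hn ▸ hk)),
            coeff_eq_zero_of_natDegree_lt (p := f) (hn ▸ hk)]
      · rw [hcard]
        refine lt_of_le_of_lt (degree_sum_le _ _) ?_
        rw [Finset.sup_lt_iff (WithBot.bot_lt_coe _)]
        intro ρ hρ
        have hρ' : ρ ∈ f.roots := by simpa using hρ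
        rw [← smul_eq_C_mul]
        refine lt_of_le_of_lt (degree_smul_le _ _) ?_
        rw [← hn, ← degree_eq_natDegree hf0]
        exact degree_divByMonic_lt _ _ hf0 (by simp)
      · intro σ hσ
        have hσ' : σ ∈ f.roots := by simpa using hσ
        have hfσ : f.eval σ = 0 := isRoot_of_mem_roots hσ'
        rw [eval_finsetSum, Finset.sum_eq_single σ]
        · have := (hloc σ _ (hqe σ hσ')).1
          simp [hfσ, this]
        · intro ρ hρ hne
          have hρ' : ρ ∈ f.roots := by simpa using hρ
          have := congrArg (eval σ) (hqe ρ hρ')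
          rw [hfσ, eval_mul] at this
          have h5 : eval σ (q ρ) = 0 := by
            rcases mul_eq_zero.mp this.symm with h | h
            · simp [sub_eq_zero] at h; exact absurd h.symm hne
            · exact h
          simp [h5]
        · intro h; exact absurd hσ h
    have : g = C κ * f + ∑ ρ ∈ f.roots.toFinset, C (g.eval ρ / (q ρ).eval ρ) * q ρ := by
      rw [← hrep]; ring
    rw [this, map_add, map_sum, ← smul_eq_C_mul, map_smul, hLf, smul_zero, zero_add]
    refine Finset.sum_nonneg fun ρ hρ => ?_
    have hρ' : ρ ∈ f.roots := by simpa using hρ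
    rw [← smul_eq_C_mul, map_smul, smul_eq_mul]
    refine mul_nonneg ?_ (hL ρ _ (hqe ρ hρ'))
    obtain ⟨h1, h2⟩ := hloc ρ _ (hqe ρ hρ')
    rw [div_eq_mul_inv]
    have : g.eval ρ * ((q ρ).eval ρ)⁻¹ = (g.eval ρ * (q ρ).eval ρ) * (((q ρ).eval ρ)⁻¹) ^ 2 := by
      field_simp
    rw [this]
    positivity

/-! ### The one-variable barrier step and interlacing -/

theorem sq_card_le_sum_mul_sum_inv (s : Multiset ℝ) (hs : ∀ y ∈ s, 0 < y) :
    (s.card : ℝ) ^ 2 ≤ s.sum * (s.map (·⁻¹)).sum := by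
  induction s using Multiset.induction with
  | empty => simp
  | cons y s ih =>
    have hy : 0 < y := hs y (by simp)
    have h := ih fun z hz => hs z (by simp [hz])
    have hY : 0 ≤ s.sum := Multiset.sum_nonneg fun z hz => (hs z (by simp [hz])).le
    have hW : 0 ≤ (s.map (·⁻¹)).sum := Multiset.sum_nonneg fun z hz => by
      obtain ⟨z', hz', rfl⟩ := Multiset.mem_map.mp hz
      exact (inv_pos.mpr (hs z' (by simp [hz']))).le
    simp only [Multiset.card_cons, Multiset.sum_cons, Multiset.map_cons]
    push_cast
    set Y := s.sum
    set W := (s.map (·⁻¹)).sum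
    set n : ℝ := (s.card : ℝ)
    have h2 : 2 * n ≤ y⁻¹ * Y + y * W := by
      have hn : 0 ≤ n := Nat.cast_nonneg _
      have e : (y⁻¹ * Y) * (y * W) = Y * W := by field_simp
      refine abs_le_of_sq_le_sq' ?_ (by positivity) |>.2
      nlinarith [sq_nonneg (y⁻¹ * Y - y * W)]
    have e : (y + Y) * (y⁻¹ + W) = 1 + (y⁻¹ * Y + y * W) + Y * W := by
      field_simp
      ring
    rw [e]
    nlinarith

/-- `d/dX` iterated `n - 1` times, up to a factorial, evaluated at `x`, on polynomials of degree at
most `n`. -/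
noncomputable def topPair (n : ℕ) (x : ℝ) : ℝ[X] →ₗ[ℝ] ℝ :=
  (n * x) • lcoeff ℝ n + lcoeff ℝ n ∘ₗ LinearMap.mulLeft ℝ X

theorem topPair_apply (n : ℕ) (x : ℝ) (f : ℝ[X]) :
    topPair n x f = n * x * f.coeff n + (X * f).coeff n := by
  simp [topPair]

theorem coeff_X_mul_natDegree_of_splits {K : Type*} [Field K] {f : K[X]} (hf : f.Splits) :
    (X * f).coeff f.natDegree = - (f.leadingCoeff * f.roots.sum) := by
  have := hf.nextCoeff_eq_neg_sum_roots_mul_leadingCoeff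
  rcases Nat.eq_zero_or_pos f.natDegree with h0 | h0
  · have : f.roots = 0 := by
      rw [← Multiset.card_eq_zero, ← hf.natDegree_eq_card_roots, h0]
    simp [h0, this]
  · obtain ⟨n, hn⟩ : ∃ n, f.natDegree = n + 1 := ⟨_, (Nat.succ_pred_eq_of_pos h0).symm⟩
    rw [hn, coeff_X_mul]
    rw [nextCoeff_of_natDegree_pos h0, hn] at this
    simpa using this

/-- On `g = f / (X - ρ)` the claim becomes `x - ρ ≤ ∑ (x - σ) - n δ`, that is, `n δ` is at most the
sum of `x - σ` over the other `n - 1` roots. Cauchy–Schwarz bounds that sum below by `(n - 1)² / φ`,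
because the logarithmic derivative `∑ 1 / (x - σ)` is at most `φ`. Taking for `g` a derivative in
another variable shows that its barrier does not grow. -/
theorem barrier_step {f : ℝ[X]} (hf : f.Splits) {n : ℕ} (hn : f.natDegree = n) (hn1 : 1 ≤ n)
    (hlead : 0 < f.leadingCoeff) {x φ δ : ℝ} (hpos : ∀ y, x ≤ y → 0 < f.eval y)
    (hφ : 0 < φ) (hder : f.derivative.eval x ≤ φ * f.eval x)
    (hδ : n * φ * δ ≤ ((n : ℝ) - 1) ^ 2) :
    0 < topPair n (x - δ) f ∧ ∀ g : ℝ[X], g.natDegree ≤ n →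
      (∀ w : ℂ, 0 < w.im → (aeval w g * conj (aeval w f)).im ≤ 0) →
      topPair n (x - δ) g * f.eval x ≤ g.eval x * topPair n (x - δ) f := by
  have hf0 : f ≠ 0 := by rintro rfl; simp at hlead
  have hlt : ∀ ρ ∈ f.roots, ρ < x := by
    intro ρ hρ
    by_contra h
    have := hpos ρ (not_lt.mp h)
    rw [isRoot_of_mem_roots hρ] at this
    exact lt_irrefl _ this
  have hcard : (f.roots.card : ℝ) = n := by
    rw [← hf.natDegree_eq_card_roots, hn]
  have hqf : topPair n (x - δ) f = f.leadingCoeff * ((f.roots.map (x - ·)).sum - n * δ) := by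
    rw [topPair_apply]
    have h1 := coeff_X_mul_natDegree_of_splits hf
    rw [hn] at h1
    rw [h1, ← hn, coeff_natDegree, hn]
    have : (f.roots.map (x - ·)).sum = n * x - f.roots.sum := by
      rw [Multiset.sum_map_sub]
      simp [hcard]
    rw [this]
    ring
  have hsum : (f.roots.map (fun ρ => (x - ρ)⁻¹)).sum ≤ φ := by
    have h1 := hf.eval_derivative_div_eval_of_ne_zero (hpos x le_rfl).ne'
    have h2 : f.derivative.eval x / f.eval x ≤ φ := by
      rw [div_le_iff₀ (hpos x le_rfl)]; exact hder
    rw [h1] at h2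
    simpa using h2
  have hkey : ∀ ρ ∈ f.roots, x - ρ ≤ (f.roots.map (x - ·)).sum - n * δ := by
    intro ρ hρ
    obtain ⟨s, hs⟩ := Multiset.exists_cons_of_mem hρ
    have hy : 0 < x - ρ := sub_pos.mpr (hlt ρ hρ)
    have hs' : ∀ y ∈ s.map (x - ·), 0 < y := by
      intro y hy
      obtain ⟨σ, hσ, rfl⟩ := Multiset.mem_map.mp hy
      exact sub_pos.mpr (hlt σ (by rw [hs]; simp [hσ]))
    have h1 := sq_card_le_sum_mul_sum_inv _ hs'
    rw [Multiset.map_map] at h1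
    rw [hs] at hsum hcard ⊢
    simp only [Multiset.map_cons, Multiset.sum_cons, Multiset.card_cons, Multiset.card_map,
      Function.comp_def] at hsum hcard h1 ⊢
    push_cast at hcard
    have hY : 0 ≤ (s.map (x - ·)).sum := Multiset.sum_nonneg fun z hz => (hs' z hz).le
    have hW : (s.map (fun σ => (x - σ)⁻¹)).sum ≤ φ := by
      have := inv_pos.mpr hy
      linarith
    have h2 := mul_le_mul_of_nonneg_left hW hY
    have h3 : (s.card : ℝ) = n - 1 := by linarith
    rw [h3] at h1
    have h4 : φ * (n * δ) ≤ φ * (s.map (x - ·)).sum := by nlinarith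
    have := le_of_mul_le_mul_left h4 hφ
    linarith
  have hqpos : 0 < topPair n (x - δ) f := by
    obtain ⟨ρ, hρ⟩ : ∃ ρ, ρ ∈ f.roots := by
      apply Multiset.exists_mem_of_ne_zero
      intro h
      rw [h, Multiset.card_zero, Nat.cast_zero] at hcard
      have : n = 0 := by exact_mod_cast hcard.symm
      omega
    rw [hqf]
    have := hkey ρ hρ
    have := sub_pos.mpr (hlt ρ hρ)
    exact mul_pos hlead (by linarith)
  refine ⟨hqpos, fun g hg him => ?_⟩
  have := nonneg_of_im_nonpos_of_splits hf0 hf (hn.symm ▸ hg) him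
    ((topPair n (x - δ) f) • leval x - (f.eval x) • topPair n (x - δ))
    (by simp [leval]; ring) ?_
  · simp [leval] at this
    linarith
  · intro ρ h e
    have hρ : ρ ∈ f.roots := by
      rw [mem_roots hf0]; simp [e]
    have hh0 : h ≠ 0 := by rintro rfl; simp at e; exact hf0 e
    have hy : 0 < x - ρ := sub_pos.mpr (hlt ρ hρ)
    have hdeg : n = h.natDegree + 1 := by
      rw [← hn, e, natDegree_mul (X_sub_C_ne_zero ρ) hh0, natDegree_X_sub_C, add_comm]
    have hl : h.leadingCoeff = f.leadingCoeff := by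
      rw [e, leadingCoeff_mul, leadingCoeff_X_sub_C, one_mul]
    have hq : topPair n (x - δ) h = f.leadingCoeff := by
      rw [topPair_apply, hdeg, coeff_X_mul, coeff_natDegree, hl,
        coeff_eq_zero_of_natDegree_lt (Nat.lt_succ_self _)]
      simp
    have he : f.eval x = (x - ρ) * h.eval x := by rw [e]; simp
    have hhpos : 0 < h.eval x := by
      have := hpos x le_rfl
      rw [he] at this
      exact pos_of_mul_pos_right this hy.le
    simp only [LinearMap.sub_apply, LinearMap.smul_apply, leval_apply, smul_eq_mul, hq, he]
    rw [hqf]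
    have := mul_le_mul_of_nonneg_left (hkey ρ hρ) (mul_pos hlead hhpos).le
    nlinarith

/-- Interlacing without naming roots of the summands. If the largest root of `Q` were at least `b`,
the sum would be nonpositive there. Hence `Q > 0` on `[b, ∞)`, where each `(X * Q - G k) / Q = X - G
k / Q` is increasing; a summand positive at `b` stays positive. -/
theorem exists_pos_of_sum_pos {κ : Type*} [Fintype κ] {Q : ℝ[X]} (hQ : Q.Splits)
    (hlead : 0 < Q.leadingCoeff) (G : κ → ℝ[X]) (hdeg : ∀ k, (G k).natDegree ≤ Q.natDegree)
    (him : ∀ k, ∀ w : ℂ, 0 < w.im → (aeval w (G k) * conj (aeval w Q)).im ≤ 0) {b : ℝ}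
    (hsum : ∀ x, b ≤ x → 0 < ∑ k, (X * Q - G k).eval x) :
    ∃ k, ∀ x, b ≤ x → 0 < (X * Q - G k).eval x := by
  have hQ0 : Q ≠ 0 := by rintro rfl; simp at hlead
  have hpos_gt : ∀ c, (∀ ρ ∈ Q.roots, ρ < c) → 0 < Q.eval c := by
    intro c hc
    rw [hQ.eval_eq_prod_roots]
    refine mul_pos hlead (Multiset.prod_pos ?_)
    intro y hy
    obtain ⟨σ, hσ, rfl⟩ := Multiset.mem_map.mp hy
    exact sub_pos.mpr (hc σ hσ)
  have hroots : ∀ ρ ∈ Q.roots, ρ < b := by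
    by_contra hcon
    push Not at hcon
    obtain ⟨ρ₀, hρ₀, hbρ₀⟩ := hcon
    obtain ⟨lam, hlam, hmax⟩ := Q.roots.toFinset.exists_max_image id ⟨ρ₀, by simpa using hρ₀⟩
    have hblam : b ≤ lam := hbρ₀.trans (hmax ρ₀ (by simpa using hρ₀))
    have hlam' : Q.eval lam = 0 := isRoot_of_mem_roots (by simpa using hlam)
    have key : 0 ≤ (leval lam) (∑ k, G k) := by
      refine nonneg_of_im_nonpos_of_splits hQ0 hQ
        (natDegree_sum_le_of_forall_le _ _ fun k _ => hdeg k) ?_ (leval lam) (by simpa [leval] using hlam') ?_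
      · intro w hw
        rw [map_sum, Finset.sum_mul, Complex.im_sum]
        exact Finset.sum_nonpos fun k _ => him k w hw
      · intro ρ h e
        rw [leval_apply]
        by_cases hne : ρ = lam
        · subst hne
          have hh : 0 < h.leadingCoeff := by
            rwa [e, leadingCoeff_mul, leadingCoeff_X_sub_C, one_mul] at hlead
          have hhs : h.Splits := splits_X_sub_C_mul_iff.mp (e ▸ hQ)
          rw [hhs.eval_eq_prod_roots]
          refine mul_nonneg hh.le (Multiset.prod_nonneg ?_)
          intro y hy
          obtain ⟨σ, hσ, rfl⟩ := Multiset.mem_map.mp hy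
          have : σ ∈ Q.roots := by
            rw [mem_roots hQ0, e]
            have := isRoot_of_mem_roots hσ
            simp [IsRoot.def] at this
            simp [this]
          exact sub_nonneg.mpr (hmax σ (by simpa using this))
        · have : (lam - ρ) * h.eval lam = 0 := by rw [← hlam', e]; simp
          rcases mul_eq_zero.mp this with h1 | h1
          · exact absurd (by linarith : ρ = lam) hne
          · exact h1.ge
    have h2 := hsum lam hblam
    simp only [eval_sub, eval_mul, hlam', mul_zero, zero_sub, Finset.sum_neg_distrib] at h2
    rw [leval_apply, eval_finsetSum] at key
    linarith
  have hQpos : ∀ x, b ≤ x → 0 < Q.eval x := fun x hx =>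
    hpos_gt x fun ρ hρ => (hroots ρ hρ).trans_le hx
  obtain ⟨k, -, hk⟩ := Finset.exists_lt_of_sum_lt (s := Finset.univ) (f := fun _ : κ => (0 : ℝ))
    (g := fun k => (X * Q - G k).eval b) (by rw [Finset.sum_const_zero]; exact hsum b le_rfl)
  refine ⟨k, fun x hx => ?_⟩
  have mono : (G k).eval x * Q.eval b ≤ (G k).eval b * Q.eval x := by
    have := nonneg_of_im_nonpos_of_splits hQ0 hQ (hdeg k) (him k)
      ((Q.eval x) • leval b - (Q.eval b) • leval x) (by simp [leval]; ring) ?_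
    · simp [leval] at this
      linarith
    · intro ρ h e
      have hρ : ρ ∈ Q.roots := by
        rw [mem_roots hQ0]; simp [e]
      have hb := sub_pos.mpr (hroots ρ hρ)
      have h1 : Q.eval x = (x - ρ) * h.eval x := by rw [e]; simp
      have h2 : Q.eval b = (b - ρ) * h.eval b := by rw [e]; simp
      have p1 : 0 < h.eval x := pos_of_mul_pos_right (h1 ▸ hQpos x hx) (by linarith)
      have p2 : 0 < h.eval b := pos_of_mul_pos_right (h2 ▸ hQpos b le_rfl) (by linarith)
      simp only [LinearMap.sub_apply, LinearMap.smul_apply, leval_apply, smul_eq_mul, h1, h2]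
      have : 0 ≤ (x - b) * (h.eval x * h.eval b) := mul_nonneg (by linarith) (by positivity)
      linarith
  simp only [eval_sub, eval_mul, eval_X] at hk ⊢
  have p1 := hQpos x hx
  have p2 := hQpos b le_rfl
  have h3 : (G k).eval b * Q.eval x < b * Q.eval b * Q.eval x := by nlinarith
  have h4 : b * Q.eval b * Q.eval x ≤ x * Q.eval x * Q.eval b := by
    nlinarith [mul_nonneg (sub_nonneg.mpr hx) (mul_pos p1 p2).le]
  have h5 : (G k).eval x * Q.eval b < x * Q.eval x * Q.eval b := by linarith
  have := lt_of_mul_lt_mul_right h5 p2.le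
  linarith

/-! ### Complex polynomials with roots in the closed lower half-plane -/

section Complex
variable {F : ℂ[X]}

theorem im_derivative_mul_conj_nonpos (hroots : ∀ ρ, F.eval ρ = 0 → ρ.im ≤ 0)
    {w : ℂ} (hw : 0 < w.im) : (F.derivative.eval w * conj (F.eval w)).im ≤ 0 := by
  have hFw : F.eval w ≠ 0 := fun h => absurd (hroots w h) (not_le.mpr hw)
  have h1 := (IsAlgClosed.splits F).eval_derivative_div_eval_of_ne_zero hFw
  have h2 : F.derivative.eval w * conj (F.eval w) =
      ((Complex.normSq (F.eval w) : ℝ) : ℂ) * (F.derivative.eval w / F.eval w) := by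
    rw [← Complex.mul_conj]
    field_simp
  rw [h2, Complex.im_ofReal_mul, h1]
  refine mul_nonpos_of_nonneg_of_nonpos (Complex.normSq_nonneg _) ?_
  have h3 : ∀ s : Multiset ℂ, (∀ ρ ∈ s, ρ.im ≤ 0) →
      ((s.map fun z => 1 / (w - z)).sum).im ≤ 0 := by
    intro s
    induction s using Multiset.induction with
    | empty => simp
    | cons a s ih =>
      intro hs
      simp only [Multiset.map_cons, Multiset.sum_cons, Complex.add_im]
      refine add_nonpos ?_ (ih fun ρ hρ => hs ρ (by simp [hρ]))
      have := hs a (by simp)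
      simp only [one_div, Complex.inv_im, Complex.sub_im]
      exact div_nonpos_of_nonpos_of_nonneg (by linarith) (Complex.normSq_nonneg _)
  exact h3 _ fun ρ hρ => hroots ρ (isRoot_of_mem_roots hρ)

/-- Each factor satisfies `|w - ρ| ≥ Im w`. Being quantitative, this form of nonvanishing survives a
limit in the other variables. -/
theorem norm_leadingCoeff_mul_im_pow_le (hroots : ∀ ρ, F.eval ρ = 0 → ρ.im ≤ 0)
    {w : ℂ} (hw : 0 < w.im) : ‖F.leadingCoeff‖ * w.im ^ F.natDegree ≤ ‖F.eval w‖ := by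
  rw [(IsAlgClosed.splits F).eval_eq_prod_roots, norm_mul,
    (IsAlgClosed.splits F).natDegree_eq_card_roots]
  refine mul_le_mul_of_nonneg_left ?_ (norm_nonneg _)
  have h3 : ∀ s : Multiset ℂ, (∀ ρ ∈ s, ρ.im ≤ 0) →
      w.im ^ s.card ≤ ‖(s.map fun z => w - z).prod‖ := by
    intro s
    induction s using Multiset.induction with
    | empty => simp
    | cons a s ih =>
      intro hs
      simp only [Multiset.map_cons, Multiset.prod_cons, norm_mul, Multiset.card_cons, pow_succ']
      refine mul_le_mul ?_ (ih fun ρ hρ => hs ρ (by simp [hρ])) (by positivity) (norm_nonneg _)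
      have := hs a (by simp)
      have h4 := Complex.abs_im_le_norm (w - a)
      rw [Complex.sub_im] at h4
      exact le_trans (by linarith) ((le_abs_self _).trans h4)
  exact h3 _ fun ρ hρ => hroots ρ (isRoot_of_mem_roots hρ)

/-- Gauss–Lucas for the `(n-1)`-st derivative: its only root is the mean of the roots of `F`, which
stays in the closed lower half-plane. -/
theorem natDegree_mul_coeff_add_ne_zero (hroots : ∀ ρ, F.eval ρ = 0 → ρ.im ≤ 0)
    {n : ℕ} (hn : F.natDegree = n) (hn1 : 1 ≤ n)
    {w : ℂ} (hw : 0 < w.im) : n * w * F.coeff n + (X * F).coeff n ≠ 0 := by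
  have hF0 : F ≠ 0 := by rintro rfl; simp at hn; omega
  have h1 := coeff_X_mul_natDegree_of_splits (IsAlgClosed.splits F)
  rw [hn] at h1
  have h2 : F.coeff n = F.leadingCoeff := by rw [← hn, coeff_natDegree]
  rw [h1, h2]
  have h3 : n * w * F.leadingCoeff + -(F.leadingCoeff * F.roots.sum) =
      F.leadingCoeff * (n * w - F.roots.sum) := by ring
  rw [h3]
  refine mul_ne_zero (leadingCoeff_ne_zero.mpr hF0) fun h => ?_
  have h4 : ∀ s : Multiset ℂ, (∀ ρ ∈ s, ρ.im ≤ 0) → s.sum.im ≤ 0 := by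
    intro s
    induction s using Multiset.induction with
    | empty => simp
    | cons a s ih =>
      intro hs
      simp only [Multiset.sum_cons, Complex.add_im]
      exact add_nonpos (hs a (by simp)) (ih fun ρ hρ => hs ρ (by simp [hρ]))
  have h5 := h4 F.roots fun ρ hρ => hroots ρ (isRoot_of_mem_roots hρ)
  have h6 := congrArg Complex.im h
  simp at h6
  have : (0 : ℝ) < n * w.im := mul_pos (by exact_mod_cast hn1) hw
  linarith

theorem exists_real_polynomial (hreal : ∀ x : ℝ, (F.eval (x : ℂ)).im = 0) :
    ∃ f : ℝ[X], f.map Complex.ofRealHom = F := by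
  have hconj : F.map (starRingEnd ℂ) = F := by
    refine Polynomial.eq_of_infinite_eval_eq _ _ (Set.Infinite.mono ?_
      (Set.infinite_range_of_injective Complex.ofReal_injective))
    rintro _ ⟨x, rfl⟩
    have h1 : (F.map (starRingEnd ℂ)).eval (conj (x : ℂ)) = conj (F.eval (x : ℂ)) := by
      exact eval_map_apply _ _
    rw [Set.mem_ofPred_eq]
    rw [Complex.conj_ofReal] at h1
    rw [h1, Complex.conj_eq_iff_im.mpr (hreal x)]
  have : F ∈ lifts Complex.ofRealHom := by
    rw [lifts_iff_coeff_lifts]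
    intro n
    have h2 := congrArg (fun p => coeff p n) hconj
    simp only [coeff_map] at h2
    exact ⟨(F.coeff n).re, Complex.conj_eq_iff_re.mp h2⟩
  exact (mem_lifts _).mp this

theorem splits_of_aeval_ne_zero {f : ℝ[X]} (h : ∀ w : ℂ, 0 < w.im → aeval w f ≠ 0) :
    f.Splits := by
  refine Splits.of_splits_map Complex.ofRealHom (IsAlgClosed.splits _) ?_
  intro w hw
  have h0 : aeval w f = 0 := by
    have := isRoot_of_mem_roots hw
    rwa [IsRoot.def, eval_map] at this
  have h1 : w.im = 0 := by
    rcases lt_trichotomy w.im 0 with hneg | h | hpos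
    · refine absurd ?_ (h (conj w) (by simpa using hneg))
      rw [aeval_conj, h0, map_zero]
    · exact h
    · exact absurd h0 (h w hpos)
  exact ⟨w.re, Complex.ext (by simp) (by simp [h1])⟩

end Complex

/-! ### Mixed determinants -/

namespace Paving

set_option linter.unusedSectionVars false

variable {ι κ : Type*} [Fintype ι] [DecidableEq ι] [Fintype κ] [DecidableEq κ]

/-- The principal minor of `diagonal z - A` on `S`. -/
noncomputable def minor (A : Matrix ι ι ℂ) (S : Finset ι) (z : ι → ℂ) : ℂ :=
  Matrix.det (Matrix.of fun i j =>
    if i ∈ S then (Matrix.diagonal z - A) i j else (1 : Matrix ι ι ℂ) i j)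

/-- Put `i` into the `k`-th set. -/
def addTo (S : κ → Finset ι) (k : κ) (i : ι) : κ → Finset ι :=
  Function.update S k (insert i (S k))

/-- Put `i` into every set. -/
def addAll (S : κ → Finset ι) (i : ι) : κ → Finset ι := fun k => insert i (S k)

/-- Put `i` into every set but the `k`-th. -/
def addBut (S : κ → Finset ι) (i : ι) (k : κ) : κ → Finset ι :=
  Function.update (addAll S i) k (S k)

/-- The sum, over all ways to distribute the elements of `T` among the sets `S k`, of the product of
the principal minors of `diagonal z - A`. -/
noncomputable def mixed (A : Matrix ι ι ℂ) : List ι → (κ → Finset ι) → (ι → ℂ) → ℂ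
  | [], S, z => ∏ k, minor A (S k) z
  | i :: T, S, z => ∑ k, mixed A T (addTo S k i) z

variable {A : Matrix ι ι ℂ}

theorem addTo_addAll (S : κ → Finset ι) (k : κ) (i j : ι) :
    addTo (addAll S i) k j = addAll (addTo S k j) i := by
  ext l : 1
  by_cases h : l = k
  · subst h; simp [addTo, addAll, Finset.insert_comm]
  · simp [addTo, addAll, h]

theorem addTo_addBut (S : κ → Finset ι) (k l : κ) (i j : ι) :
    addTo (addBut S i k) l j = addBut (addTo S l j) i k := by
  ext m : 1
  by_cases h : m = l <;> by_cases h' : m = k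
  · subst h; subst h'; simp [addTo, addBut]
  · subst h; simp [addTo, addBut, addAll, h', Finset.insert_comm]
  · subst h'; simp [addTo, addBut, h]
  · simp [addTo, addBut, addAll, h, h']

theorem addTo_comm (S : κ → Finset ι) (k l : κ) (i j : ι) :
    addTo (addTo S k i) l j = addTo (addTo S l j) k i := by
  ext m : 1
  by_cases h : m = l <;> by_cases h' : m = k
  · subst h; subst h'; simp [addTo, Finset.insert_comm]
  · subst h; simp [addTo, h']
  · subst h'; simp [addTo, h]
  · simp [addTo, h, h']

theorem notMem_addTo {S : κ → Finset ι} {i j : ι} (hij : i ≠ j) (hS : ∀ k, i ∉ S k) (l : κ) :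
    ∀ k, i ∉ addTo S l j k := by
  intro k
  by_cases h : k = l
  · subst h; simp [addTo, hij, hS]
  · simp [addTo, h, hS]

theorem notMem_addAll {S : κ → Finset ι} {i j : ι} (hij : i ≠ j) (hS : ∀ k, i ∉ S k) :
    ∀ k, i ∉ addAll S j k := by
  intro k; simp [addAll, hij, hS]

theorem minor_empty (z : ι → ℂ) : minor A ∅ z = 1 := by
  simp only [minor, Finset.notMem_empty, if_false]
  exact Matrix.det_one

theorem minor_update {S : Finset ι} {i : ι} (hi : i ∉ S) (z : ι → ℂ) (v : ℂ) :
    minor A S (Function.update z i v) = minor A S z := by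
  unfold minor
  congr 1
  ext k j
  by_cases hk : k ∈ S
  · have hki : k ≠ i := fun h => hi (h ▸ hk)
    by_cases hkj : k = j
    · subst hkj; simp [hk, hki]
    · simp [hk, hkj]
  · simp [hk]

theorem exists_minor_insert {S : Finset ι} {i : ι} (hi : i ∉ S) (z : ι → ℂ) :
    ∃ E, ∀ v, minor A (insert i S) (Function.update z i v) = v * minor A S z + E := by
  set B : Matrix ι ι ℂ := Matrix.of fun i j =>
    if i ∈ S then (Matrix.diagonal z - A) i j else (1 : Matrix ι ι ℂ) i j with hB
  refine ⟨(B.updateRow i (fun j => - A i j)).det, fun v => ?_⟩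
  have h1 : (Matrix.of fun k j => if k ∈ insert i S then
      (Matrix.diagonal (Function.update z i v) - A) k j else (1 : Matrix ι ι ℂ) k j) =
      B.updateRow i (v • B i + fun j => - A i j) := by
    ext k j
    by_cases hki : k = i
    · subst hki
      by_cases hkj : k = j
      · subst hkj; simp [hB, hi]; ring
      · simp [hB, hi, hkj]
    · by_cases hk : k ∈ S
      · by_cases hkj : k = j
        · subst hkj; simp [hB, hk, hki]
        · simp [hB, hk, hki, hkj]
      · simp [hB, hk, hki]
  unfold minor
  rw [h1, Matrix.det_updateRow_add, Matrix.det_updateRow_smul, Matrix.updateRow_eq_self]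

theorem mixed_update {T : List ι} {S : κ → Finset ι} {i : ι} (hT : i ∉ T) (hS : ∀ k, i ∉ S k)
    (z : ι → ℂ) (v : ℂ) : mixed A T S (Function.update z i v) = mixed A T S z := by
  induction T generalizing S with
  | nil => exact Finset.prod_congr rfl fun k _ => minor_update (hS k) z v
  | cons j T ih =>
    simp only [List.mem_cons, not_or] at hT
    exact Finset.sum_congr rfl fun k _ => ih hT.2 (notMem_addTo hT.1 hS k)

/-- Expanding along row `i` makes the one minor containing `i` affine in `z i`, with slope the minor
without `i`; sums and the other factors preserve this. -/
theorem exists_mixed_addTo {T : List ι} {S : κ → Finset ι} {i : ι} (hT : i ∉ T)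
    (hS : ∀ k, i ∉ S k) (k : κ) (z : ι → ℂ) :
    ∃ E, ∀ v, mixed A T (addTo S k i) (Function.update z i v) = v * mixed A T S z + E := by
  induction T generalizing S with
  | nil =>
    obtain ⟨E, hE⟩ := exists_minor_insert (A := A) (hS k) z
    refine ⟨E * ∏ l ∈ Finset.univ.erase k, minor A (S l) z, fun v => ?_⟩
    simp only [mixed]
    rw [← Finset.mul_prod_erase _ _ (Finset.mem_univ k),
      ← Finset.mul_prod_erase _ (fun l => minor A (S l) z) (Finset.mem_univ k)]
    have : ∀ l ∈ Finset.univ.erase k, minor A (addTo S k i l) (Function.update z i v) =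
        minor A (S l) z := by
      intro l hl
      have hl' := Finset.ne_of_mem_erase hl
      simp only [addTo, Function.update_of_ne hl']
      exact minor_update (hS l) z v
    rw [Finset.prod_congr rfl this]
    simp only [addTo, Function.update_self, hE]
    ring
  | cons j T ih =>
    simp only [List.mem_cons, not_or] at hT
    choose E hE using fun l => ih hT.2 (notMem_addTo hT.1 hS l)
    refine ⟨∑ l, E l, fun v => ?_⟩
    simp only [mixed]
    rw [Finset.mul_sum, ← Finset.sum_add_distrib]
    refine Finset.sum_congr rfl fun l _ => ?_
    rw [addTo_comm, hE]

/-- The coefficients are read at the formal degree `s.card`, since some `D k` may vanish. -/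
theorem exists_prod_linear_polynomial (D E : κ → ℂ) (s : Finset κ) :
    ∃ F : ℂ[X], F.natDegree ≤ s.card ∧ F.coeff s.card = ∏ k ∈ s, D k ∧
      (X * F).coeff s.card = ∑ k ∈ s, E k * ∏ l ∈ s.erase k, D l ∧
      (∀ w, F.eval w = ∏ k ∈ s, (w * D k + E k)) ∧
      ∀ w, F.derivative.eval w = ∑ k ∈ s, D k * ∏ l ∈ s.erase k, (w * D l + E l) := by
  induction s using Finset.induction_on with
  | empty => exact ⟨1, by simp⟩
  | insert a s ha ih =>
    obtain ⟨F, h1, h2, h3, h4, h5⟩ := ih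
    have her : ∀ k ∈ s, (insert a s).erase k = insert a (s.erase k) := fun k hk =>
      Finset.erase_insert_of_ne (fun h => ha (h ▸ hk))
    have ha' : ∀ k, a ∉ s.erase k := fun k h => ha (Finset.mem_of_mem_erase h)
    refine ⟨(C (D a) * X + C (E a)) * F, ?_, ?_, ?_, ?_, ?_⟩
    · rw [Finset.card_insert_of_notMem ha, add_comm s.card]
      exact natDegree_mul_le_of_le natDegree_linear_le h1
    · rw [Finset.card_insert_of_notMem ha, Finset.prod_insert ha, ← h2, add_mul, mul_assoc,
        coeff_add, coeff_C_mul, coeff_C_mul, coeff_X_mul,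
        coeff_eq_zero_of_natDegree_lt (Nat.lt_succ_of_le h1)]
      simp
    · rw [Finset.card_insert_of_notMem ha, Finset.sum_insert ha, Finset.erase_insert ha, ← h2]
      have : X * ((C (D a) * X + C (E a)) * F) = C (D a) * (X * (X * F)) + C (E a) * (X * F) := by
        ring
      rw [this, coeff_add, coeff_C_mul, coeff_C_mul, coeff_X_mul, coeff_X_mul, h3, Finset.mul_sum,
        add_comm]
      congr 1
      refine Finset.sum_congr rfl fun k hk => ?_
      rw [her k hk, Finset.prod_insert (ha' k)]
      ring
    · intro w
      rw [Finset.prod_insert ha, ← h4]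
      simp only [eval_mul, eval_add, eval_C, eval_X]
      ring
    · intro w
      rw [Finset.sum_insert ha, Finset.erase_insert ha, ← h4]
      simp only [derivative_mul, eval_add, eval_mul, h5, Finset.mul_sum]
      congr 1
      · simp
      · refine Finset.sum_congr rfl fun k hk => ?_
        rw [her k hk, Finset.prod_insert (ha' k)]
        simp
        ring

/-- `mixed A T (addAll S i)` as a polynomial in the variable `z i`. -/
theorem exists_mixed_polynomial {T : List ι} {S : κ → Finset ι} {i : ι} (hT : i ∉ T)
    (hS : ∀ k, i ∉ S k) (z : ι → ℂ) :
    ∃ F : ℂ[X], F.natDegree ≤ Fintype.card κ ∧ F.coeff (Fintype.card κ) = mixed A T S z ∧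
      (∀ w, (Fintype.card κ) * w * F.coeff (Fintype.card κ) + (X * F).coeff (Fintype.card κ) =
        mixed A (i :: T) S (Function.update z i w)) ∧
      (∀ w, F.eval w = mixed A T (addAll S i) (Function.update z i w)) ∧
      ∀ w, F.derivative.eval w = ∑ k, mixed A T (addBut S i k) (Function.update z i w) := by
  induction T generalizing S with
  | nil =>
    choose E hE using fun k => exists_minor_insert (A := A) (hS k) z
    obtain ⟨F, h1, h2, h3, h4, h5⟩ :=
      exists_prod_linear_polynomial (fun k => minor A (S k) z) E Finset.univ
    rw [Finset.card_univ] at h1 h2 h3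
    refine ⟨F, h1, h2, fun w => ?_, fun w => ?_, fun w => ?_⟩
    · rw [h2, h3]
      simp only [mixed]
      have : ∀ k, ∏ l, minor A (addTo S k i l) (Function.update z i w) =
          w * ∏ l, minor A (S l) z + E k * ∏ l ∈ Finset.univ.erase k, minor A (S l) z := by
        intro k
        rw [← Finset.mul_prod_erase _ _ (Finset.mem_univ k),
          ← Finset.mul_prod_erase _ (fun l => minor A (S l) z) (Finset.mem_univ k)]
        have : ∀ l ∈ Finset.univ.erase k, minor A (addTo S k i l) (Function.update z i w) =
            minor A (S l) z := by
          intro l hl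
          have hl' := Finset.ne_of_mem_erase hl
          simp only [addTo, Function.update_of_ne hl']
          exact minor_update (hS l) z w
        rw [Finset.prod_congr rfl this]
        simp only [addTo, Function.update_self, hE]
        ring
      simp_rw [this]
      rw [Finset.sum_add_distrib, Finset.sum_const, Finset.card_univ]
      simp
      ring
    · rw [h4]
      simp only [mixed, addAll, hE]
    · rw [h5]
      simp only [mixed]
      refine Finset.sum_congr rfl fun k _ => ?_
      rw [← Finset.mul_prod_erase Finset.univ (fun l => minor A (addBut S i k l) _)
        (Finset.mem_univ k)]
      congr 1
      · simp only [addBut, Function.update_self]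
        exact (minor_update (hS k) z w).symm
      · refine Finset.prod_congr rfl fun l hl => ?_
        have hl' := Finset.ne_of_mem_erase hl
        simp only [addBut, Function.update_of_ne hl', addAll, hE]
  | cons j T ih =>
    simp only [List.mem_cons, not_or] at hT
    choose F h1 h2 h3 h4 h5 using fun l => ih hT.2 (notMem_addTo hT.1 hS l)
    refine ⟨∑ l, F l, natDegree_sum_le_of_forall_le _ _ fun l _ => h1 l, ?_, fun w => ?_,
      fun w => ?_, fun w => ?_⟩
    · rw [finsetSum_coeff]
      simp only [h2, mixed]
    · rw [Finset.mul_sum, finsetSum_coeff, finsetSum_coeff, Finset.mul_sum,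
        ← Finset.sum_add_distrib]
      simp only [h3, mixed]
      rw [Finset.sum_comm]
      refine Finset.sum_congr rfl fun k _ => Finset.sum_congr rfl fun l _ => ?_
      rw [addTo_comm]
    · rw [eval_finsetSum]
      simp only [h4, mixed]
      refine Finset.sum_congr rfl fun k _ => ?_
      rw [addTo_addAll]
    · rw [derivative_sum, eval_finsetSum]
      simp only [h5, mixed]
      rw [Finset.sum_comm]
      refine Finset.sum_congr rfl fun k _ => Finset.sum_congr rfl fun l _ => ?_
      rw [addTo_addBut]

/-! ### Continuity, reality and restriction to the diagonal -/

theorem continuous_minor (S : Finset ι) : Continuous (minor A S) := by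
  unfold minor
  refine Continuous.matrix_det (continuous_matrix fun i j => ?_)
  by_cases h : i ∈ S
  · simp only [Matrix.of_apply, h, if_true, Matrix.sub_apply]
    by_cases hij : i = j
    · subst hij; simp only [Matrix.diagonal_apply_eq]; fun_prop
    · simp only [Matrix.diagonal_apply_ne _ hij]; fun_prop
  · simp only [Matrix.of_apply, h, if_false]; fun_prop

theorem continuous_mixed (T : List ι) (S : κ → Finset ι) : Continuous (mixed A T S) := by
  induction T generalizing S with
  | nil => exact continuous_finsetProd _ fun k _ => continuous_minor _
  | cons j T ih => exact continuous_finsetSum _ fun k _ => ih _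

theorem minor_eq_det_submatrix (S : Finset ι) (z : ι → ℂ) :
    minor A S z = (Matrix.diagonal (fun i : S => z i) -
      A.submatrix (Subtype.val : S → ι) Subtype.val).det := by
  unfold minor
  rw [Matrix.twoBlockTriangular_det _ (fun i => i ∈ S)]
  · have h1 : (Matrix.toSquareBlockProp (Matrix.of fun i j => if i ∈ S then
        (Matrix.diagonal z - A) i j else (1 : Matrix ι ι ℂ) i j) fun i => i ∈ S) =
        Matrix.diagonal (fun i : S => z i) - A.submatrix (Subtype.val : S → ι) Subtype.val := by
      ext i j
      rw [Matrix.toSquareBlockProp_def, Matrix.of_apply, Matrix.of_apply, if_pos i.2,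
        Matrix.sub_apply, Matrix.sub_apply, Matrix.submatrix_apply, Matrix.diagonal_apply,
        Matrix.diagonal_apply]
      simp only [Subtype.ext_iff]
    have h2 : (Matrix.toSquareBlockProp (Matrix.of fun i j => if i ∈ S then
        (Matrix.diagonal z - A) i j else (1 : Matrix ι ι ℂ) i j) fun i => ¬ i ∈ S) = 1 := by
      ext i j
      rw [Matrix.toSquareBlockProp_def, Matrix.of_apply, Matrix.of_apply, if_neg i.2,
        Matrix.one_apply, Matrix.one_apply]
      simp only [Subtype.ext_iff]
    rw [h2, Matrix.det_one, mul_one, h1]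
    congr!
  · intro i hi j hj
    rw [Matrix.of_apply, if_neg hi, Matrix.one_apply_ne]
    rintro rfl
    exact hi hj

theorem conj_minor (hA : A.IsHermitian) (S : Finset ι) (z : ι → ℂ) :
    conj (minor A S z) = minor A S (fun i => conj (z i)) := by
  rw [minor_eq_det_submatrix, minor_eq_det_submatrix, starRingEnd_apply, ← Matrix.det_conjTranspose,
    Matrix.conjTranspose_sub, (hA.submatrix _).eq, Matrix.diagonal_conjTranspose]
  rfl

theorem conj_mixed (hA : A.IsHermitian) (T : List ι) (S : κ → Finset ι) (z : ι → ℂ) :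
    conj (mixed A T S z) = mixed A T S (fun i => conj (z i)) := by
  induction T generalizing S with
  | nil => simp only [mixed, map_prod, conj_minor hA]
  | cons j T ih => simp only [mixed, map_sum, ih]

theorem im_mixed_ofReal (hA : A.IsHermitian) (T : List ι) (S : κ → Finset ι) (x : ι → ℝ) :
    (mixed A T S (fun i => (x i : ℂ))).im = 0 := by
  rw [← Complex.conj_eq_iff_im, conj_mixed hA]
  simp

theorem exists_minor_diagonal_polynomial (S : Finset ι) :
    ∃ Q : ℂ[X], (∀ w, Q.eval w = minor A S fun _ => w) ∧ Q.Monic ∧ Q.natDegree = S.card := by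
  refine ⟨(A.submatrix (Subtype.val : S → ι) Subtype.val).charpoly, fun w => ?_,
    Matrix.charpoly_monic _, ?_⟩
  · rw [Matrix.eval_charpoly, minor_eq_det_submatrix]
    rfl
  · rw [Matrix.charpoly_natDegree_eq_dim, Fintype.card_coe]

/-- Each complete distribution contributes a product of monic characteristic polynomials of total
degree `N`; the top coefficient counts the distributions. -/
theorem exists_mixed_diagonal_polynomial {T : List ι} (hT : T.Nodup)
    {S : κ → Finset ι} (hS : ∀ i ∈ T, ∀ k, i ∉ S k) {N : ℕ}
    (hN : N = T.length + ∑ k, (S k).card) :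
    ∃ Q : ℂ[X], (∀ w, Q.eval w = mixed A T S fun _ => w) ∧ Q.natDegree ≤ N ∧
      Q.coeff N = (Fintype.card κ : ℂ) ^ T.length := by
  induction T generalizing S with
  | nil =>
    choose Q h1 h2 h3 using fun k => exists_minor_diagonal_polynomial (A := A) (S k)
    have hd : (∏ k, Q k).natDegree = N := by
      rw [natDegree_prod_of_monic _ _ fun k _ => h2 k, hN]
      simp [h3]
    refine ⟨∏ k, Q k, fun w => ?_, hd.le, ?_⟩
    · rw [eval_prod]
      simp only [h1, mixed]
    · rw [← hd, coeff_natDegree]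
      simpa using (monic_prod_of_monic _ _ fun k _ => h2 k).leadingCoeff
  | cons i T ih =>
    rw [List.nodup_cons] at hT
    have hc : ∀ k, ∑ l, (addTo S k i l).card = 1 + ∑ l, (S l).card := by
      intro k
      rw [← Finset.add_sum_erase _ _ (Finset.mem_univ k),
        ← Finset.add_sum_erase _ (fun l => (S l).card) (Finset.mem_univ k), ← add_assoc]
      congr 1
      · simp only [addTo, Function.update_self]
        rw [Finset.card_insert_of_notMem (hS i List.mem_cons_self k), add_comm]
      · refine Finset.sum_congr rfl fun l hl => ?_
        simp only [addTo, Function.update_of_ne (Finset.ne_of_mem_erase hl)]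
    choose Q h1 h2 h3 using fun k => ih hT.2 (S := addTo S k i)
      (fun j hj => notMem_addTo (by rintro rfl; exact hT.1 hj)
        (hS j (List.mem_cons_of_mem _ hj)) k)
      (by rw [hN, hc, List.length_cons]; ring)
    refine ⟨∑ k, Q k, fun w => ?_, natDegree_sum_le_of_forall_le _ _ fun k _ => h2 k, ?_⟩
    · rw [eval_finsetSum]
      simp only [h1, mixed]
    · rw [finsetSum_coeff]
      simp [h3, pow_succ']

/-- The restriction of a mixed determinant to the diagonal is a real polynomial. -/
theorem exists_mixed_diagonal_real_polynomial (hA : A.IsHermitian) {T : List ι} (hT : T.Nodup)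
    {S : κ → Finset ι} (hS : ∀ i ∈ T, ∀ k, i ∉ S k) {N : ℕ}
    (hN : N = T.length + ∑ k, (S k).card) :
    ∃ Q : ℝ[X], (∀ w : ℂ, aeval w Q = mixed A T S fun _ => w) ∧ Q.natDegree ≤ N ∧
      Q.coeff N = (Fintype.card κ : ℝ) ^ T.length := by
  obtain ⟨F, h1, h2, h3⟩ := exists_mixed_diagonal_polynomial (A := A) hT hS hN
  obtain ⟨Q, rfl⟩ := exists_real_polynomial (F := F) fun x => by
    rw [h1]; exact im_mixed_ofReal hA T S fun _ => x
  refine ⟨Q, fun w => ?_, ?_, ?_⟩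
  · rw [← h1, eval_map]
    rfl
  · rwa [natDegree_map] at h2
  · rw [coeff_map] at h3
    have : ((Q.coeff N : ℝ) : ℂ) = (((Fintype.card κ : ℝ) ^ T.length : ℝ) : ℂ) := by
      push_cast; exact h3
    exact_mod_cast this

/-! ### Stability -/

theorem exists_ne_zero_of_minor_eq_zero {S : Finset ι} {z : ι → ℂ} (h0 : minor A S z = 0) :
    ∃ v : ι → ℂ, v ≠ 0 ∧ (∀ i ∉ S, v i = 0) ∧
      dotProduct (star v) (A.mulVec v) = ∑ i, z i * ((Complex.normSq (v i) : ℝ) : ℂ) := by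
  obtain ⟨v, hv, hBv⟩ := Matrix.exists_mulVec_eq_zero_iff.mpr h0
  have h1 : ∀ i ∉ S, v i = 0 := by
    intro i hi
    have := congrFun hBv i
    simpa [Matrix.mulVec, dotProduct, hi, Matrix.one_apply] using this
  have h2 : ∀ i ∈ S, z i * v i = (A.mulVec v) i := by
    intro i hi
    have := congrFun hBv i
    simp only [Matrix.mulVec, dotProduct, Matrix.of_apply, hi, if_true, Matrix.sub_apply, sub_mul,
      Finset.sum_sub_distrib, Pi.zero_apply, Matrix.diagonal_apply, ite_mul, zero_mul,
      Finset.sum_ite_eq, Finset.mem_univ] at this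
    simpa [Matrix.mulVec, dotProduct] using sub_eq_zero.mp this
  refine ⟨v, hv, h1, Finset.sum_congr rfl fun i _ => ?_⟩
  by_cases hi : i ∈ S
  · rw [← h2 i hi, ← Complex.mul_conj]
    simp
    ring
  · simp [h1 i hi]

/-- A kernel vector would equate the real number `⟨v, A v⟩` with `∑ z i |v i|²`, whose imaginary
part is positive. -/
theorem minor_ne_zero (hA : A.IsHermitian) (S : Finset ι) {z : ι → ℂ} (hz : ∀ i, 0 < (z i).im) :
    minor A S z ≠ 0 := by
  intro h0
  obtain ⟨v, hv, -, h3⟩ := exists_ne_zero_of_minor_eq_zero h0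
  have h4 : (dotProduct (star v) (A.mulVec v)).im = 0 := hA.im_star_dotProduct_mulVec_self v
  rw [h3, Complex.im_sum] at h4
  have h5 : ∀ i, (z i * ((Complex.normSq (v i) : ℝ) : ℂ)).im = (z i).im * Complex.normSq (v i) := by
    intro i; simp
  simp_rw [h5] at h4
  rw [Finset.sum_eq_zero_iff_of_nonneg fun i _ =>
    mul_nonneg (hz i).le (Complex.normSq_nonneg _)] at h4
  refine hv (funext fun i => ?_)
  rcases mul_eq_zero.mp (h4 i (Finset.mem_univ i)) with h | h
  · exact absurd h (hz i).ne'
  · exact Complex.normSq_eq_zero.mp h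

theorem update_im_pos {z : ι → ℂ} (hz : ∀ i, 0 < (z i).im) (i : ι) {w : ℂ} (hw : 0 < w.im) :
    ∀ j, 0 < (Function.update z i w j).im := by
  intro j
  by_cases h : j = i
  · subst h; simpa
  · simpa [h] using hz j

/-- Mixed determinants of Hermitian matrices are stable. -/
theorem mixed_ne_zero [Nonempty κ] (hA : A.IsHermitian) {T : List ι} (hT : T.Nodup)
    {S : κ → Finset ι} (hS : ∀ i ∈ T, ∀ k, i ∉ S k) {z : ι → ℂ} (hz : ∀ i, 0 < (z i).im) :
    mixed A T S z ≠ 0 := by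
  induction T generalizing S z with
  | nil => exact Finset.prod_ne_zero_iff.mpr fun k _ => minor_ne_zero hA _ hz
  | cons i T ih =>
    rw [List.nodup_cons] at hT
    obtain ⟨F, h1, h2, h3, h4, -⟩ :=
      exists_mixed_polynomial (A := A) hT.1 (hS i List.mem_cons_self) z
    have hc : F.coeff (Fintype.card κ) ≠ 0 := by
      rw [h2]
      exact ih hT.2 (fun j hj => hS j (List.mem_cons_of_mem _ hj)) hz
    -- The induction hypothesis with `i` in every set locates the roots of `F`; Gauss–Lucas then
    -- handles `i :: T`, the `(r-1)`-st derivative of `F` up to a factorial.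
    have hr : ∀ ρ, F.eval ρ = 0 → ρ.im ≤ 0 := by
      intro ρ hρ
      by_contra hcon
      rw [h4] at hρ
      refine ih hT.2 (fun j hj => notMem_addAll ?_ (hS j (List.mem_cons_of_mem _ hj)))
        (update_im_pos hz i (not_le.mp hcon)) hρ
      rintro rfl
      exact hT.1 hj
    have := natDegree_mul_coeff_add_ne_zero hr (natDegree_eq_of_le_of_coeff_ne_zero h1 hc)
      Fintype.card_pos (hz i)
    rwa [h3, Function.update_eq_self] at this

/-! ### Positivity and the barrier estimate -/

theorem le_of_im_pos_of_continuous {F G : (ι → ℂ) → ℝ} (hF : Continuous F) (hG : Continuous G)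
    (h : ∀ z : ι → ℂ, (∀ i, 0 < (z i).im) → F z ≤ G z) {z : ι → ℂ} (hz : ∀ i, 0 ≤ (z i).im) :
    F z ≤ G z := by
  have hc : Continuous fun t : ℝ => fun i => z i + t * Complex.I := by fun_prop
  have h1 := (hF.comp hc).continuousWithinAt (x := 0) (s := Set.Ioi 0)
  have h2 := (hG.comp hc).continuousWithinAt (x := 0) (s := Set.Ioi 0)
  have := le_of_tendsto_of_tendsto h1.tendsto h2.tendsto (by
    filter_upwards [self_mem_nhdsWithin] with t ht
    refine h _ fun i => ?_
    have : 0 < t := ht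
    simpa using add_pos_of_nonneg_of_pos (hz i) this)
  simpa using this

section
variable [Nonempty κ] (hA : A.IsHermitian) {T : List ι} (hT : T.Nodup) {S : κ → Finset ι}
  (hS : ∀ i ∈ T, ∀ k, i ∉ S k) {j : ι} (hjT : j ∉ T) (hjS : ∀ k, j ∉ S k)
include hA hT hS hjT hjS

theorem exists_stable_polynomial {z : ι → ℂ} (hz : ∀ i, 0 < (z i).im) :
    ∃ F : ℂ[X], (∀ ρ, F.eval ρ = 0 → ρ.im ≤ 0) ∧ F.natDegree = Fintype.card κ ∧
      F.leadingCoeff = mixed A T S z ∧ F.eval (z j) = mixed A T (addAll S j) z ∧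
      F.derivative.eval (z j) = ∑ k, mixed A T (addBut S j k) z := by
  obtain ⟨F, h1, h2, -, h4, h5⟩ := exists_mixed_polynomial (A := A) hjT hjS z
  have hne : F.coeff (Fintype.card κ) ≠ 0 := by
    rw [h2]; exact mixed_ne_zero hA hT hS hz
  have hd := natDegree_eq_of_le_of_coeff_ne_zero h1 hne
  refine ⟨F, fun ρ hρ => ?_, hd, ?_, ?_, ?_⟩
  · by_contra hcon
    rw [h4] at hρ
    refine mixed_ne_zero hA hT (fun i hi => notMem_addAll ?_ (hS i hi))
      (update_im_pos hz j (not_le.mp hcon)) hρ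
    rintro rfl
    exact hjT hi
  · rw [← h2, ← hd, coeff_natDegree]
  · rw [h4, Function.update_eq_self]
  · rw [h5, Function.update_eq_self]

/-- The sum is the derivative in `z j` of the determinant with `j` in every set. The inequality
passes to the closed half-plane, so it applies when only a different coordinate is nonreal. -/
theorem im_sum_addBut_mul_conj_nonpos {z : ι → ℂ} (hz : ∀ i, 0 ≤ (z i).im) :
    ((∑ k, mixed A T (addBut S j k) z) * conj (mixed A T (addAll S j) z)).im ≤ 0 := by
  refine le_of_im_pos_of_continuous (G := fun _ => 0)
    (F := fun z => ((∑ k, mixed A T (addBut S j k) z) * conj (mixed A T (addAll S j) z)).im)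
    ?_ continuous_const (fun z hz => ?_) hz
  · exact Complex.continuous_im.comp ((continuous_finsetSum _ fun k _ => continuous_mixed _ _).mul
      (Complex.continuous_conj.comp (continuous_mixed _ _)))
  · obtain ⟨F, h1, -, -, h4, h5⟩ := exists_stable_polynomial hA hT hS hjT hjS hz
    have := im_derivative_mul_conj_nonpos h1 (hz j)
    rwa [h4, h5] at this

theorem norm_mixed_mul_im_pow_le {z : ι → ℂ} (hz : ∀ i, 0 ≤ (z i).im) :
    ‖mixed A T S z‖ * (z j).im ^ Fintype.card κ ≤ ‖mixed A T (addAll S j) z‖ := by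
  refine le_of_im_pos_of_continuous
    (F := fun z => ‖mixed A T S z‖ * (z j).im ^ Fintype.card κ)
    (G := fun z => ‖mixed A T (addAll S j) z‖) ?_ ?_ (fun z hz => ?_) hz
  · exact (continuous_mixed _ _).norm.mul ((Complex.continuous_im.comp (continuous_apply j)).pow _)
  · exact (continuous_mixed _ _).norm
  · obtain ⟨F, h1, h2, h3, h4, -⟩ := exists_stable_polynomial hA hT hS hjT hjS hz
    have := norm_leadingCoeff_mul_im_pow_le h1 (hz j)
    rwa [h2, h3, h4] at this

end

theorem ofReal_update (x : ι → ℝ) (i : ι) (y : ℝ) :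
    (fun j => ((Function.update x i y j : ℝ) : ℂ)) = Function.update (fun j => (x j : ℂ)) i y := by
  ext j
  by_cases h : j = i
  · subst h; simp
  · simp [h]

/-- The value of a mixed determinant at a real point. -/
noncomputable def mixedR (A : Matrix ι ι ℂ) (T : List ι) (S : κ → Finset ι) (x : ι → ℝ) : ℝ :=
  (mixed A T S fun i => (x i : ℂ)).re

theorem ofReal_mixedR (hA : A.IsHermitian) (T : List ι) (S : κ → Finset ι) (x : ι → ℝ) :
    (mixedR A T S x : ℂ) = mixed A T S fun i => (x i : ℂ) :=
  Complex.conj_eq_iff_re.mp (Complex.conj_eq_iff_im.mpr (im_mixed_ofReal hA T S x))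

theorem mixedR_update {T : List ι} {S : κ → Finset ι} {i : ι} (hT : i ∉ T) (hS : ∀ k, i ∉ S k)
    (x : ι → ℝ) (y : ℝ) : mixedR A T S (Function.update x i y) = mixedR A T S x := by
  unfold mixedR
  rw [ofReal_update, mixed_update hT hS]

theorem exists_mixedR_polynomial (hA : A.IsHermitian) {T : List ι} {S : κ → Finset ι} {i : ι}
    (hT : i ∉ T) (hS : ∀ k, i ∉ S k) (x : ι → ℝ) :
    ∃ f : ℝ[X], f.natDegree ≤ Fintype.card κ ∧ f.coeff (Fintype.card κ) = mixedR A T S x ∧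
      topPair (Fintype.card κ) (x i) f = mixedR A (i :: T) S x ∧
      (∀ y, f.eval y = mixedR A T (addAll S i) (Function.update x i y)) ∧
      (∀ y, f.derivative.eval y = ∑ k, mixedR A T (addBut S i k) (Function.update x i y)) ∧
      ∀ w : ℂ, aeval w f = mixed A T (addAll S i) (Function.update (fun j => (x j : ℂ)) i w) := by
  obtain ⟨F, h1, h2, h3, h4, h5⟩ := exists_mixed_polynomial (A := A) hT hS fun j => (x j : ℂ)
  obtain ⟨f, rfl⟩ := exists_real_polynomial (F := F) fun y => by
    rw [h4, ← ofReal_update]; exact im_mixed_ofReal hA _ _ _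
  have he : ∀ (p : ℝ[X]) (y : ℝ), ((p.eval y : ℝ) : ℂ) = (p.map Complex.ofRealHom).eval (y : ℂ) :=
    fun p y => (eval_map_apply (f := Complex.ofRealHom) _).symm
  refine ⟨f, by rwa [natDegree_map] at h1, ?_, ?_, fun y => ?_, fun y => ?_, fun w => ?_⟩
  · apply Complex.ofReal_injective
    rw [ofReal_mixedR hA, ← h2, coeff_map]
    rfl
  · apply Complex.ofReal_injective
    have := h3 (x i)
    rw [Function.update_eq_self] at this
    rw [ofReal_mixedR hA, ← this, topPair_apply, coeff_map, ← map_X Complex.ofRealHom,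
      ← Polynomial.map_mul, coeff_map]
    push_cast
    rfl
  · apply Complex.ofReal_injective
    rw [ofReal_mixedR hA, he, h4, ofReal_update]
  · apply Complex.ofReal_injective
    rw [he, ← derivative_map, h5]
    push_cast
    refine Finset.sum_congr rfl fun k _ => ?_
    rw [ofReal_mixedR hA, ofReal_update]
  · rw [← h4, eval_map]
    rfl

theorem addAll_addBut (S : κ → Finset ι) (i j : ι) (k : κ) :
    addAll (addBut S j k) i = addBut (addAll S i) j k := by
  ext l : 1
  by_cases h : l = k
  · subst h; simp [addAll, addBut]
  · simp [addAll, addBut, h, Finset.insert_comm]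

/-- Two assertions are carried together: positivity, and the bound `φ` on the logarithmic derivative
in every direction `j` not yet used. Moving `i` into `T` applies `barrier_step` in the variable `x
i`, from `x i + δ` down to `x i`. The bound does not deteriorate, so the same `δ` serves at every
step. -/
theorem mixedR_pos_and_barrier [Nonempty κ] (hA : A.IsHermitian) {t δ φ : ℝ} (hφ : 0 < φ)
    (hδ : Fintype.card κ * φ * δ ≤ ((Fintype.card κ : ℝ) - 1) ^ 2)
    (hbase : ∀ (U : Finset ι) (x : ι → ℝ), (∀ j, t ≤ x j) →
      0 < mixedR A [] (fun _ : κ => U) x ∧ ∀ j, j ∉ U →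
        ∑ k : κ, mixedR A [] (addBut (fun _ => U) j k) x ≤
          φ * mixedR A [] (fun _ : κ => insert j U) x)
    {T : List ι} (hT : T.Nodup) {U : Finset ι} (hU : ∀ i ∈ T, i ∉ U) {x : ι → ℝ}
    (hx : ∀ j ∈ T, t - δ ≤ x j) (hx' : ∀ j, j ∉ T → t ≤ x j) :
    0 < mixedR A T (fun _ : κ => U) x ∧ ∀ j, j ∉ U → j ∉ T →
      ∑ k : κ, mixedR A T (addBut (fun _ => U) j k) x ≤
        φ * mixedR A T (fun _ : κ => insert j U) x := by
  induction T generalizing U x with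
  | nil =>
    obtain ⟨h1, h2⟩ := hbase U x fun j => hx' j (by simp)
    exact ⟨h1, fun j hj _ => h2 j hj⟩
  | cons i T ih =>
    rw [List.nodup_cons] at hT
    have hup : ∀ y, x i + δ ≤ y → (∀ j ∈ T, t - δ ≤ Function.update x i y j) ∧
        ∀ j, j ∉ T → t ≤ Function.update x i y j := by
      intro y hy
      refine ⟨fun j hj => ?_, fun j hj => ?_⟩
      · have : j ≠ i := by rintro rfl; exact hT.1 hj
        simpa [this] using hx j (List.mem_cons_of_mem _ hj)
      · by_cases hji : j = i
        · subst hji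
          have := hx j List.mem_cons_self
          simp only [Function.update_self]
          linarith
        · simpa [hji] using hx' j (by simp [hji, hj])
    have hIH : ∀ {U : Finset ι}, (∀ j ∈ T, j ∉ U) → ∀ y, x i + δ ≤ y →
        0 < mixedR A T (fun _ : κ => U) (Function.update x i y) ∧ ∀ j, j ∉ U → j ∉ T →
          ∑ k : κ, mixedR A T (addBut (fun _ => U) j k) (Function.update x i y) ≤
            φ * mixedR A T (fun _ : κ => insert j U) (Function.update x i y) :=
      fun hU y hy => ih hT.2 hU (hup y hy).1 (hup y hy).2
    -- Used with `U` for positivity and with `insert j U` for the barrier in direction `j`.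
    have key : ∀ U : Finset ι, (∀ j ∈ i :: T, j ∉ U) → ∃ f : ℝ[X],
        (∀ w : ℂ, aeval w f = mixed A T (fun _ : κ => insert i U)
          (Function.update (fun j => (x j : ℂ)) i w)) ∧
        (∀ y, f.eval y = mixedR A T (fun _ : κ => insert i U) (Function.update x i y)) ∧
        topPair (Fintype.card κ) (x i) f = mixedR A (i :: T) (fun _ : κ => U) x ∧
        0 < f.eval (x i + δ) ∧
        0 < topPair (Fintype.card κ) (x i) f ∧ ∀ g : ℝ[X], g.natDegree ≤ Fintype.card κ →
          (∀ w : ℂ, 0 < w.im → (aeval w g * conj (aeval w f)).im ≤ 0) →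
          topPair (Fintype.card κ) (x i) g * f.eval (x i + δ) ≤
            g.eval (x i + δ) * topPair (Fintype.card κ) (x i) f := by
      intro U hU
      have hiU : i ∉ U := hU i List.mem_cons_self
      have hTU : ∀ j ∈ T, j ∉ U := fun j hj => hU j (List.mem_cons_of_mem _ hj)
      have hTU' : ∀ j ∈ T, j ∉ insert i U := by
        intro j hj
        have : j ≠ i := by rintro rfl; exact hT.1 hj
        simp [this, hTU j hj]
      obtain ⟨f, h1, h2, h3, h4, h5, h6⟩ :=
        exists_mixedR_polynomial (κ := κ) hA (S := fun _ => U) hT.1 (fun _ => hiU) x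
      have hlead : 0 < mixedR A T (fun _ : κ => U) x := by
        have := (hIH hTU _ le_rfl).1
        rwa [mixedR_update hT.1 fun _ => hiU] at this
      have hd := natDegree_eq_of_le_of_coeff_ne_zero h1 (h2 ▸ hlead.ne')
      -- The other coordinates are real, so stability alone does not exclude zeros; the quantitative
      -- lower bound does, as the leading coefficient is positive.
      have hsplit : f.Splits := by
        refine splits_of_aeval_ne_zero fun w hw => ?_
        rw [h6]
        have hz : ∀ j, 0 ≤ (Function.update (fun j => (x j : ℂ)) i w j).im := by
          intro j
          by_cases hji : j = i
          · subst hji; simpa using hw.le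
          · simp [hji]
        have := norm_mixed_mul_im_pow_le (κ := κ) hA hT.2 (S := fun _ => U)
          (fun j hj _ => hTU j hj) hT.1 (fun _ => hiU) hz
        rw [mixed_update hT.1 fun _ => hiU, ← ofReal_mixedR hA, Function.update_self] at this
        rw [← norm_pos_iff]
        refine lt_of_lt_of_le ?_ this
        have h8 : (0 : ℝ) < ‖(mixedR A T (fun _ : κ => U) x : ℂ)‖ := by
          rw [norm_pos_iff]
          exact_mod_cast hlead.ne'
        positivity
      have hpos : ∀ y, x i + δ ≤ y → 0 < f.eval y := by
        intro y hy
        rw [h4]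
        exact (hIH hTU' y hy).1
      obtain ⟨h7, h8⟩ := barrier_step hsplit hd Fintype.card_pos
        (by rw [← coeff_natDegree, hd, h2]; exact hlead) hpos hφ
        (by rw [h5, h4]; exact (hIH hTU _ le_rfl).2 i hiU hT.1) hδ
      rw [add_sub_cancel_right] at h7 h8
      exact ⟨f, h6, h4, h3, hpos _ le_rfl, h7, h8⟩
    refine ⟨?_, fun j hjU hjT => ?_⟩
    · obtain ⟨f, -, -, h3, -, h4, -⟩ := key U hU
      rwa [h3] at h4
    · simp only [List.mem_cons, not_or] at hjT
      have hiU : i ∉ U := hU i List.mem_cons_self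
      have hTU : ∀ j ∈ T, j ∉ U := fun j hj => hU j (List.mem_cons_of_mem _ hj)
      have hTU' : ∀ l ∈ T, l ∉ insert i U := by
        intro l hl
        have : l ≠ i := by rintro rfl; exact hT.1 hl
        simp [this, hTU l hl]
      obtain ⟨f, h6, h4, h3, hf, hq, hg⟩ := key (insert j U) (by
        intro l hl
        have : l ≠ j := by
          rintro rfl
          rcases List.mem_cons.mp hl with h | h
          · exact hjT.1 h
          · exact hjT.2 h
        simp [this, hU l hl])
      have hiS : ∀ k l : κ, i ∉ addBut (fun _ => U) j k l := by
        intro k l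
        by_cases hkl : l = k
        · subst hkl; simpa [addBut] using hiU
        · simpa [addBut, hkl, addAll, hiU] using Ne.symm hjT.1
      choose g g1 g2 g3 g4 g5 g6 using fun k : κ =>
        exists_mixedR_polynomial hA (S := addBut (fun _ : κ => U) j k) hT.1 (hiS k) x
      have main := hg (∑ k, g k) (natDegree_sum_le_of_forall_le _ _ fun k _ => g1 k) (by
        intro w hw
        have hz : ∀ j, 0 ≤ (Function.update (fun j => (x j : ℂ)) i w j).im := by
          intro j
          by_cases hji : j = i
          · subst hji; simpa using hw.le
          · simp [hji]
        have := im_sum_addBut_mul_conj_nonpos (κ := κ) hA hT.2 (S := fun _ => insert i U)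
          (fun l hl _ => hTU' l hl) hjT.2 (fun _ => by simp [hjT.1, hjU]) hz
        rw [map_sum, h6]
        simp only [g6, addAll_addBut]
        rw [Finset.insert_comm]
        exact this)
      have h9 : (∑ k, g k).eval (x i + δ) ≤ φ * f.eval (x i + δ) := by
        rw [eval_finsetSum, h4, Finset.insert_comm]
        simp only [g4, addAll_addBut]
        exact (hIH hTU' _ le_rfl).2 j (by simp [hjT.1, hjU]) hjT.2
      have h10 : topPair (Fintype.card κ) (x i) (∑ k, g k) * f.eval (x i + δ) ≤
          φ * topPair (Fintype.card κ) (x i) f * f.eval (x i + δ) := by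
        have := mul_le_mul_of_nonneg_right h9 hq.le
        linarith
      have h11 := le_of_mul_le_mul_right h10 hf
      rw [map_sum, h3] at h11
      simpa only [g3] using h11

/-! ### Principal minors -/

theorem mixedR_nil_const (hA : A.IsHermitian) (S : κ → Finset ι) (x : ι → ℝ) :
    mixedR A [] S x = ∏ k, (minor A (S k) fun i => (x i : ℂ)).re := by
  apply Complex.ofReal_injective
  rw [ofReal_mixedR hA]
  push_cast
  refine Finset.prod_congr rfl fun k _ => ?_
  refine (Complex.conj_eq_iff_re.mp ?_).symm
  rw [conj_minor hA]
  simp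

/-- The hypothesis says that `t - A` stays positive semidefinite after subtracting `m` from one
diagonal entry. As a function of the `j`-th variable, the larger minor is affine with slope the
smaller one, and its zero lies at or below `x j - m`. Thus the logarithmic derivative is at most `1
/ m`. -/
theorem minor_re_pos_and_le (hA : A.IsHermitian) {t m : ℝ} (hm : 0 < m)
    (hPD : ∀ (v : ι → ℂ) j, m * Complex.normSq (v j) ≤
      t * ∑ i, Complex.normSq (v i) - (dotProduct (star v) (A.mulVec v)).re)
    {x : ι → ℝ} (hx : ∀ j, t ≤ x j) (U : Finset ι) :
    0 < (minor A U fun i => (x i : ℂ)).re ∧ ∀ j, j ∉ U →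
      m * (minor A U fun i => (x i : ℂ)).re ≤ (minor A (insert j U) fun i => (x i : ℂ)).re := by
  have hreal : ∀ (U : Finset ι) (x : ι → ℝ), (((minor A U fun i => (x i : ℂ)).re : ℝ) : ℂ) =
      minor A U fun i => (x i : ℂ) := by
    intro U x
    refine Complex.conj_eq_iff_re.mp ?_
    rw [conj_minor hA]
    simp
  have hne : ∀ (U : Finset ι) j (y : ℝ), x j - m < y →
      (minor A U fun i => ((Function.update x j y i : ℝ) : ℂ)) ≠ 0 := by
    intro U j y hy h0
    obtain ⟨v, hv, -, h⟩ := exists_ne_zero_of_minor_eq_zero h0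
    have h1 : (dotProduct (star v) (A.mulVec v)).re =
        ∑ i, Function.update x j y i * Complex.normSq (v i) := by
      rw [h, Complex.re_sum]
      refine Finset.sum_congr rfl fun i _ => ?_
      rw [← Complex.ofReal_mul, Complex.ofReal_re]
    have h2 : t * ∑ i, Complex.normSq (v i) + (y - x j) * Complex.normSq (v j) ≤
        ∑ i, Function.update x j y i * Complex.normSq (v i) := by
      rw [Finset.mul_sum, ← Finset.add_sum_erase _ _ (Finset.mem_univ j),
        ← Finset.add_sum_erase _ (fun i => Function.update x j y i * Complex.normSq (v i))
          (Finset.mem_univ j), Function.update_self]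
      have h3 : ∑ i ∈ Finset.univ.erase j, t * Complex.normSq (v i) ≤
          ∑ i ∈ Finset.univ.erase j, Function.update x j y i * Complex.normSq (v i) := by
        refine Finset.sum_le_sum fun i hi => ?_
        rw [Function.update_of_ne (Finset.ne_of_mem_erase hi)]
        exact mul_le_mul_of_nonneg_right (hx i) (Complex.normSq_nonneg _)
      have h4 := mul_le_mul_of_nonneg_right (hx j) (Complex.normSq_nonneg (v j))
      linarith
    have h5 := hPD v j
    have h6 : (m + (y - x j)) * Complex.normSq (v j) ≤ 0 := by linarith
    have h7 : Complex.normSq (v j) = 0 := by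
      have := Complex.normSq_nonneg (v j)
      by_contra hc
      have : 0 < Complex.normSq (v j) := lt_of_le_of_ne this (Ne.symm hc)
      have := mul_pos (by linarith : 0 < m + (y - x j)) this
      linarith
    obtain ⟨l, hl⟩ := Function.ne_iff.mp hv
    have h8 := hPD v l
    have h9 : 0 < Complex.normSq (v l) := Complex.normSq_pos.mpr hl
    have := mul_pos hm h9
    rw [h7] at h2
    linarith
  have hstep : ∀ (U : Finset ι) j, j ∉ U → 0 < (minor A U fun i => (x i : ℂ)).re →
      m * (minor A U fun i => (x i : ℂ)).re ≤ (minor A (insert j U) fun i => (x i : ℂ)).re := by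
    intro U j hj hpos
    obtain ⟨E, hE⟩ := exists_minor_insert (A := A) hj fun i => (x i : ℂ)
    set D := (minor A U fun i => (x i : ℂ)).re with hD
    have hE' : ∀ y : ℝ, (minor A (insert j U) fun i => ((Function.update x j y i : ℝ) : ℂ)).re =
        y * D + E.re := by
      intro y
      rw [ofReal_update, hE, ← hreal U x, ← hD]
      simp
    have h1 := hE' (x j)
    rw [Function.update_eq_self] at h1
    rw [h1]
    by_contra hcon
    push Not at hcon
    have h2 : x j - m < -E.re / D := by
      rw [lt_div_iff₀ hpos]
      linarith
    refine hne (insert j U) j _ h2 ?_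
    rw [← hreal, hE', div_mul_cancel₀ _ hpos.ne']
    simp
  have hpos : ∀ U : Finset ι, 0 < (minor A U fun i => (x i : ℂ)).re := by
    intro U
    induction U using Finset.induction_on with
    | empty => simp [minor_empty]
    | insert j U hj ih => exact (mul_pos hm ih).trans_le (hstep U j hj ih)
  exact ⟨hpos U, fun j hj => hstep U j hj (hpos U)⟩

/-- For `r` equal sets the initial logarithmic derivative is at most `φ = r / m`; then `δ = (1 -
1/r)² m` makes the barrier condition `r φ δ ≤ (r - 1)²` an equality. -/
theorem mixedR_pos_of_quadratic [Nonempty κ] (hA : A.IsHermitian) {t m : ℝ} (hm : 0 < m)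
    (hPD : ∀ (v : ι → ℂ) j, m * Complex.normSq (v j) ≤
      t * ∑ i, Complex.normSq (v i) - (dotProduct (star v) (A.mulVec v)).re)
    {T : List ι} (hT : T.Nodup) (hTu : ∀ i, i ∈ T) {x : ι → ℝ}
    (hx : ∀ j, t - (1 - 1 / (Fintype.card κ : ℝ)) ^ 2 * m ≤ x j) :
    0 < mixedR A T (fun _ : κ => ∅) x := by
  set r : ℝ := (Fintype.card κ : ℝ) with hr
  have hr1 : 1 ≤ r := by rw [hr]; exact_mod_cast (Fintype.card_pos : 0 < Fintype.card κ)
  have hr0 : 0 < r := by linarith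
  refine (mixedR_pos_and_barrier (κ := κ) hA (t := t) (δ := (1 - 1 / r) ^ 2 * m) (φ := r / m)
    (by positivity) ?_ ?_ hT (by simp) (fun j _ => hx j)
    (fun j hj => absurd (hTu j) hj)).1
  · rw [← hr]
    apply le_of_eq
    field_simp
  · intro U x hx
    obtain ⟨h1, h2⟩ := minor_re_pos_and_le hA hm hPD hx U
    refine ⟨?_, fun j hj => ?_⟩
    · rw [mixedR_nil_const hA]
      exact Finset.prod_pos fun _ _ => h1
    · have h3 := h2 j hj
      set D := (minor A U fun i => (x i : ℂ)).re
      set D' := (minor A (insert j U) fun i => (x i : ℂ)).re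
      have hD' : 0 < D' := (mul_pos hm h1).trans_le h3
      have h4 : ∀ k : κ, mixedR A [] (addBut (fun _ => U) j k) x =
          D * D' ^ (Fintype.card κ - 1) := by
        intro k
        rw [mixedR_nil_const hA, ← Finset.mul_prod_erase _ _ (Finset.mem_univ k)]
        congr 1
        · simp [addBut, D]
        · rw [Finset.prod_congr rfl (g := fun _ => D')]
          · simp [Finset.card_erase_of_mem, Finset.card_univ]
          · intro l hl
            simp [addBut, Finset.ne_of_mem_erase hl, addAll, D']
      simp only [h4]
      rw [mixedR_nil_const hA, Finset.sum_const, Finset.prod_const, Finset.card_univ, nsmul_eq_mul]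
      obtain ⟨n, hn⟩ : ∃ n, Fintype.card κ = n + 1 :=
        ⟨_, (Nat.succ_pred_eq_of_pos Fintype.card_pos).symm⟩
      rw [← hr, hn, Nat.add_sub_cancel, pow_succ]
      have h5 : r * (D * D' ^ n) = r / m * (D' ^ n * (m * D)) := by
        field_simp
      rw [h5]
      gcongr

/-! ### Choosing the partition -/

/-- On the diagonal, every choice of set for `i` gives `X * Q - G k` with the same `Q`, the
determinant without `i`. Stability supplies the half-plane condition that makes the choices
interlace. -/
theorem exists_mixedR_addTo_pos [Nonempty κ] (hA : A.IsHermitian) {i : ι} {T : List ι}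
    (hT : (i :: T).Nodup) {S : κ → Finset ι} (hS : ∀ j ∈ i :: T, ∀ k, j ∉ S k) {b : ℝ}
    (h : ∀ x, b ≤ x → 0 < mixedR A (i :: T) S fun _ => x) :
    ∃ k, ∀ x, b ≤ x → 0 < mixedR A T (addTo S k i) fun _ => x := by
  rw [List.nodup_cons] at hT
  have hST : ∀ j ∈ T, ∀ k, j ∉ S k := fun j hj => hS j (List.mem_cons_of_mem _ hj)
  have hSi : ∀ k, i ∉ S k := hS i List.mem_cons_self
  have hST' : ∀ k, ∀ j ∈ T, ∀ l, j ∉ addTo S k i l := fun k j hj =>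
    notMem_addTo (by rintro rfl; exact hT.1 hj) (hST j hj) k
  obtain ⟨Q, q1, q2, q3⟩ := exists_mixed_diagonal_real_polynomial hA hT.2 hST rfl
  set N := T.length + ∑ k, (S k).card with hN
  have hc : ∀ k, N + 1 = T.length + ∑ l, (addTo S k i l).card := by
    intro k
    rw [hN, ← Finset.add_sum_erase _ _ (Finset.mem_univ k),
      ← Finset.add_sum_erase _ (fun l => (addTo S k i l).card) (Finset.mem_univ k)]
    have h1 : ∑ l ∈ Finset.univ.erase k, (addTo S k i l).card =
        ∑ l ∈ Finset.univ.erase k, (S l).card := by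
      refine Finset.sum_congr rfl fun l hl => ?_
      simp only [addTo, Function.update_of_ne (Finset.ne_of_mem_erase hl)]
    rw [h1]
    simp only [addTo, Function.update_self]
    rw [Finset.card_insert_of_notMem (hSi k)]
    ring
  choose P p1 p2 p3 using fun k => exists_mixed_diagonal_real_polynomial hA hT.2 (hST' k) (hc k)
  have hlead : (0 : ℝ) < (Fintype.card κ : ℝ) ^ T.length := by
    have : 0 < Fintype.card κ := Fintype.card_pos
    positivity
  have hd : Q.natDegree = N := natDegree_eq_of_le_of_coeff_ne_zero q2 (q3 ▸ hlead.ne')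
  have hreal : ∀ (R : ℝ[X]) (T : List ι) (S : κ → Finset ι) (x : ℝ),
      (∀ w : ℂ, aeval w R = mixed A T S fun _ => w) → R.eval x = mixedR A T S fun _ => x := by
    intro R T S x hR
    apply Complex.ofReal_injective
    rw [ofReal_mixedR hA, ← hR]
    exact (aeval_algebraMap_apply ℂ x R).symm
  have hstable : ∀ w : ℂ, 0 < w.im → aeval w Q ≠ 0 := by
    intro w hw
    rw [q1]
    exact mixed_ne_zero hA hT.2 hST fun _ => hw
  have hP : ∀ k, X * Q - (X * Q - P k) = P k := fun k => by ring
  suffices h : ∃ k, ∀ x, b ≤ x → 0 < (X * Q - (X * Q - P k)).eval x by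
    obtain ⟨k, hk⟩ := h
    refine ⟨k, fun x hx => ?_⟩
    have := hk x hx
    rw [hP, hreal _ _ _ x (p1 k)] at this
    exact this
  refine exists_pos_of_sum_pos (splits_of_aeval_ne_zero hstable)
    (by rw [← coeff_natDegree, hd, q3]; exact hlead) (fun k => X * Q - P k) (b := b) (fun k => ?_)
    (fun k w hw => ?_) (fun x hx => ?_)
  · rw [hd, natDegree_le_iff_coeff_eq_zero]
    intro n hn
    obtain ⟨n, rfl⟩ : ∃ l, n = l + 1 := ⟨n - 1, by omega⟩
    rw [coeff_sub, coeff_X_mul]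
    rcases (Nat.lt_succ_iff.mp hn).eq_or_lt with rfl | hn'
    · rw [q3, p3, sub_self]
    · rw [coeff_eq_zero_of_natDegree_lt (lt_of_le_of_lt q2 hn'),
        coeff_eq_zero_of_natDegree_lt (lt_of_le_of_lt (p2 k) (by omega)), sub_self]
  -- The determinant is `z i * Q + E`, affine in `z i`. Were `-E / Q` in the upper half-plane,
  -- substituting it for `z i` would contradict stability.
  · obtain ⟨E, hE⟩ := exists_mixed_addTo (A := A) hT.1 hSi k fun _ => w
    have h1 : aeval w (X * Q - P k) = -E := by
      have := hE w
      rw [show Function.update (fun _ : ι => w) i w = fun _ => w from Function.update_eq_self i _,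
        ← p1, ← q1] at this
      simp [this]
    rw [h1]
    by_contra hcon
    push Not at hcon
    have hQ := hstable w hw
    have h2 : 0 < (-E / aeval w Q).im := by
      have h3 : -E / aeval w Q =
          (((Complex.normSq (aeval w Q))⁻¹ : ℝ) : ℂ) * (-E * conj (aeval w Q)) := by
        rw [div_eq_mul_inv, Complex.inv_def]
        push_cast
        ring
      rw [h3, Complex.im_ofReal_mul]
      exact mul_pos (inv_pos.mpr (Complex.normSq_pos.mpr hQ)) hcon
    refine mixed_ne_zero hA hT.2 (hST' k) (update_im_pos (fun _ => hw) i h2) ?_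
    rw [hE, ← q1, div_mul_cancel₀ _ hQ, neg_add_cancel]
  · simp only [hP]
    have := h x hx
    have h3 : mixedR A (i :: T) S (fun _ => x) = ∑ k, mixedR A T (addTo S k i) fun _ => x := by
      simp only [mixedR, mixed, Complex.re_sum]
    rw [h3] at this
    simpa only [hreal _ _ _ x (p1 _)] using this

theorem exists_mixedR_nil_pos [Nonempty κ] (hA : A.IsHermitian) {T : List ι}
    (hT : T.Nodup) {S : κ → Finset ι} (hS : ∀ j ∈ T, ∀ k, j ∉ S k) {b : ℝ}
    (h : ∀ x, b ≤ x → 0 < mixedR A T S fun _ => x) :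
    ∃ S' : κ → Finset ι, (∀ k, S k ⊆ S' k) ∧ (∀ i ∈ T, ∃ k, i ∈ S' k) ∧
      ∀ x, b ≤ x → 0 < mixedR A [] S' fun _ => x := by
  induction T generalizing S with
  | nil => exact ⟨S, fun _ => subset_rfl, by simp, h⟩
  | cons i T ih =>
    obtain ⟨k, hk⟩ := exists_mixedR_addTo_pos hA hT hS h
    rw [List.nodup_cons] at hT
    obtain ⟨S', h1, h2, h3⟩ := ih hT.2 (fun j hj => notMem_addTo (by rintro rfl; exact hT.1 hj)
        (hS j (List.mem_cons_of_mem _ hj)) k) hk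
    have h4 : i ∈ S' k := h1 k (by simp [addTo])
    refine ⟨S', fun l => subset_trans ?_ (h1 l), ?_, h3⟩
    · by_cases hl : l = k
      · subst hl; simp [addTo]
      · simp [addTo, hl]
    · intro j hj
      rcases List.mem_cons.mp hj with rfl | hj
      · exact ⟨k, h4⟩
      · exact h2 j hj

/-! ### Quadratic forms -/

/-- The real part of the quadratic form of `A`. -/
noncomputable def quad (A : Matrix ι ι ℂ) (v : ι → ℂ) : ℝ := (dotProduct (star v) (A.mulVec v)).re

theorem quad_eq_sum (A : Matrix ι ι ℂ) (v : ι → ℂ) :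
    quad A v = ∑ i, ∑ j, (conj (v i) * A i j * v j).re := by
  simp only [quad, Matrix.mulVec, dotProduct, Complex.re_sum, Finset.mul_sum, Pi.star_apply,
    mul_assoc]
  rfl

theorem quad_add_smul_single (hA : A.IsHermitian) {j : ι} (hj : A j j = 0) (v : ι → ℂ) (c : ℂ) :
    quad A (v + c • Pi.single j 1) = quad A v + 2 * (conj c * (A.mulVec v) j).re := by
  have h1 : dotProduct (star (Pi.single j (1 : ℂ))) (A.mulVec v) = (A.mulVec v) j := by
    simp [dotProduct, Pi.single_apply]
  have h2 : dotProduct (star v) (A.mulVec (Pi.single j 1)) = conj ((A.mulVec v) j) := by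
    rw [← h1, starRingEnd_apply, ← Matrix.star_dotProduct_star, star_star, Matrix.star_mulVec, hA.eq,
      ← Matrix.dotProduct_mulVec]
  have h3 : dotProduct (star (Pi.single j (1 : ℂ))) (A.mulVec (Pi.single j 1)) = 0 := by
    simp [dotProduct, Pi.single_apply, hj]
  unfold quad
  rw [Matrix.mulVec_add, Matrix.mulVec_smul, star_add, star_smul, add_dotProduct, dotProduct_add,
    dotProduct_add, smul_dotProduct, smul_dotProduct, dotProduct_smul, dotProduct_smul, h1, h2, h3]
  simp
  ring

theorem sum_normSq_add_smul_single (j : ι) (v : ι → ℂ) (c : ℂ) :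
    ∑ i, Complex.normSq ((v + c • (Pi.single j 1 : ι → ℂ)) i) =
      ∑ i, Complex.normSq (v i) + 2 * (conj c * v j).re + Complex.normSq c := by
  rw [← Finset.add_sum_erase _ _ (Finset.mem_univ j),
    ← Finset.add_sum_erase _ (fun i => Complex.normSq (v i)) (Finset.mem_univ j)]
  have h1 : ∑ i ∈ Finset.univ.erase j, Complex.normSq ((v + c • (Pi.single j 1 : ι → ℂ)) i) =
      ∑ i ∈ Finset.univ.erase j, Complex.normSq (v i) := by
    refine Finset.sum_congr rfl fun i hi => ?_
    simp [Finset.ne_of_mem_erase hi]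
  rw [h1]
  simp [Complex.normSq_add]
  ring

/-- Equivalently, the `j`-th diagonal entry of `(b + s - A)⁻¹` is at most `(s + a) / (s (s + a +
b))`. The spectral measure at `e_j` lives on `[-a, b]` and has mean zero; by convexity the extreme
case has atoms only at `-a` and `b`. The proof is a quadratic-form version: `b + s - A` is a
positive combination of `b - A` and `a + A`, and each is bounded below along `e_j`. -/
theorem normSq_le_of_quad_bounds (hA : A.IsHermitian) (hdiag : ∀ j, A j j = 0) {a b s : ℝ}
    (ha : 0 < a) (hb : 0 < b) (hs : 0 < s)
    (hlow : ∀ v, -(a * ∑ i, Complex.normSq (v i)) ≤ quad A v)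
    (hupp : ∀ v, quad A v ≤ b * ∑ i, Complex.normSq (v i)) (v : ι → ℂ) (j : ι) :
    s * (s + a + b) / (s + a) * Complex.normSq (v j) ≤
      (b + s) * ∑ i, Complex.normSq (v i) - quad A v := by
  set q := ∑ i, Complex.normSq (v i)
  set y := (A.mulVec v) j
  set η := (b : ℂ) * v j - y
  set η' := (a : ℂ) * v j + y
  -- The form of `b - A` is minimised along `v + ℂ e_j`; zero diagonal makes the quadratic
  -- coefficient exactly `b`.
  have h1 : Complex.normSq η / b ≤ b * q - quad A v := by
    have := hupp (v + (-(η / b)) • Pi.single j 1)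
    rw [quad_add_smul_single hA (hdiag j), sum_normSq_add_smul_single] at this
    have e : b * (2 * (conj (-(η / b)) * v j).re + Complex.normSq (-(η / b))) -
        2 * (conj (-(η / b)) * y).re = - (Complex.normSq η / b) := by
      have e1 : (conj (-(η / b)) * v j).re = -((conj η * v j).re / b) := by
        rw [← Complex.div_ofReal_re]
        simp
        ring
      have e2 : (conj (-(η / b)) * y).re = -((conj η * y).re / b) := by
        rw [← Complex.div_ofReal_re]
        simp
        ring
      have e3 : Complex.normSq (-(η / b)) = Complex.normSq η / b ^ 2 := by
        rw [Complex.normSq_neg, Complex.normSq_div, Complex.normSq_ofReal, sq]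
      have e4 : Complex.normSq η = b * (conj η * v j).re - (conj η * y).re := by
        have : ((Complex.normSq η : ℝ) : ℂ) = b * (conj η * v j) - conj η * y := by
          rw [← Complex.mul_conj]; simp only [η]; ring
        have := congrArg Complex.re this
        simpa only [Complex.sub_re, Complex.re_ofReal_mul, Complex.ofReal_re] using this
      rw [e1, e2, e3, e4]
      field_simp
      ring
    linarith
  have h2 : Complex.normSq η' / a ≤ a * q + quad A v := by
    have := hlow (v + (-(η' / a)) • Pi.single j 1)
    rw [quad_add_smul_single hA (hdiag j), sum_normSq_add_smul_single] at this
    have e : a * (2 * (conj (-(η' / a)) * v j).re + Complex.normSq (-(η' / a))) +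
        2 * (conj (-(η' / a)) * y).re = - (Complex.normSq η' / a) := by
      have e1 : (conj (-(η' / a)) * v j).re = -((conj η' * v j).re / a) := by
        rw [← Complex.div_ofReal_re]
        simp
        ring
      have e2 : (conj (-(η' / a)) * y).re = -((conj η' * y).re / a) := by
        rw [← Complex.div_ofReal_re]
        simp
        ring
      have e3 : Complex.normSq (-(η' / a)) = Complex.normSq η' / a ^ 2 := by
        rw [Complex.normSq_neg, Complex.normSq_div, Complex.normSq_ofReal, sq]
      have e4 : Complex.normSq η' = a * (conj η' * v j).re + (conj η' * y).re := by
        have : ((Complex.normSq η' : ℝ) : ℂ) = a * (conj η' * v j) + conj η' * y := by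
          rw [← Complex.mul_conj]; simp only [η']; ring
        have := congrArg Complex.re this
        simpa only [Complex.add_re, Complex.re_ofReal_mul, Complex.ofReal_re] using this
      rw [e1, e2, e3, e4]
      field_simp
      ring
    linarith
  have h3 : (a + b) ^ 2 * Complex.normSq (v j) = Complex.normSq (η + η') := by
    have : η + η' = ((a + b : ℝ) : ℂ) * v j := by simp only [η, η']; push_cast; ring
    rw [this, Complex.normSq_mul, Complex.normSq_ofReal]
    ring
  have h4 : ∀ P Q : ℝ, P * Q * Complex.normSq (η + η') ≤
      (P + Q) * (P * Complex.normSq η + Q * Complex.normSq η') := by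
    intro P Q
    have : (P + Q) * (P * Complex.normSq η + Q * Complex.normSq η') -
        P * Q * Complex.normSq (η + η') = Complex.normSq (P * η - Q * η') := by
      simp only [Complex.normSq_apply, Complex.add_re, Complex.add_im, Complex.sub_re,
        Complex.sub_im, Complex.re_ofReal_mul, Complex.im_ofReal_mul]
      ring
    have := Complex.normSq_nonneg (P * η - Q * η')
    linarith
  -- Weights of `b - A` and `a + A` in `b + s - A`, divided by `b` and `a`. Weighted Cauchy–Schwarz
  -- then recombines `η` and `η'` into `(a + b) v j`.
  set P := (s + a + b) / (b * (a + b)) with hP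
  set Q := s / (a * (a + b)) with hQ
  have hP0 : 0 < P := by positivity
  have hQ0 : 0 < Q := by positivity
  have h5 := h4 P Q
  rw [← h3] at h5
  have h6 : P * Complex.normSq η + Q * Complex.normSq η' ≤ (b + s) * q - quad A v := by
    have e1 : P * Complex.normSq η = (s + a + b) / (a + b) * (Complex.normSq η / b) := by
      rw [hP]; field_simp
    have e2 : Q * Complex.normSq η' = s / (a + b) * (Complex.normSq η' / a) := by
      rw [hQ]; field_simp
    have e3 : (b + s) * q - quad A v = (s + a + b) / (a + b) * (b * q - quad A v) +
        s / (a + b) * (a * q + quad A v) := by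
      field_simp
      ring
    rw [e1, e2, e3]
    gcongr
  have h7 : s * (s + a + b) / (s + a) * Complex.normSq (v j) =
      P * Q * ((a + b) ^ 2 * Complex.normSq (v j)) / (P + Q) := by
    rw [hP, hQ]
    field_simp
    ring
  rw [h7, div_le_iff₀ (by positivity)]
  refine h5.trans ?_
  rw [mul_comm]
  gcongr

-- A negative eigenvalue of `b` minus the block would be an eigenvalue of the block above `b`, hence
-- a zero of the minor.
open scoped ComplexOrder in
theorem quad_le_of_minor_ne_zero (hA : A.IsHermitian) {S : Finset ι} {b : ℝ}
    (h : ∀ x : ℝ, b ≤ x → minor A S (fun _ => (x : ℂ)) ≠ 0) {v : ι → ℂ} (hv : ∀ i ∉ S, v i = 0) :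
    quad A v ≤ b * ∑ i, Complex.normSq (v i) := by
  set B := A.submatrix (Subtype.val : S → ι) Subtype.val with hB
  have hBH : B.IsHermitian := hA.submatrix _
  have hdiag : (Matrix.diagonal fun _ : S => (b : ℂ)).IsHermitian := by
    rw [Matrix.IsHermitian, Matrix.diagonal_conjTranspose]
    congr 1
    ext i
    simp
  have hCH : (Matrix.diagonal (fun _ : S => (b : ℂ)) - B).IsHermitian := hdiag.sub hBH
  have hpsd : (Matrix.diagonal (fun _ : S => (b : ℂ)) - B).PosSemidef := by
    rw [hCH.posSemidef_iff_eigenvalues_nonneg]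
    intro i
    by_contra hneg
    simp only [Pi.zero_apply, not_le] at hneg
    refine h (b - hCH.eigenvalues i) (by linarith) ?_
    rw [minor_eq_det_submatrix, ← hB]
    rw [← Matrix.exists_mulVec_eq_zero_iff]
    refine ⟨(hCH.eigenvectorBasis i).ofLp, ?_, ?_⟩
    · intro h0
      have h1 := (hCH.eigenvectorBasis.orthonormal.1 i)
      have h2 : hCH.eigenvectorBasis i = 0 := by
        ext l
        exact congrFun h0 l
      rw [h2] at h1
      simp at h1
    · have h1 := hCH.mulVec_eigenvectorBasis i
      have h2 : Matrix.diagonal (fun _ : S => ((b - hCH.eigenvalues i : ℝ) : ℂ)) - B =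
          (Matrix.diagonal (fun _ : S => (b : ℂ)) - B) -
            ((hCH.eigenvalues i : ℂ)) • (1 : Matrix S S ℂ) := by
        ext k l
        by_cases hkl : k = l
        · subst hkl; simp; ring
        · simp [hkl]
      rw [h2, Matrix.sub_mulVec, h1, Matrix.smul_mulVec, Matrix.one_mulVec]
      ext l
      simp
  have h1 : ∀ i ∉ S, Complex.normSq (v i) = 0 := fun i hi => by simp [hv i hi]
  have h2 : 0 ≤ quad (Matrix.diagonal (fun _ : S => (b : ℂ)) - B) (fun i : S => v i) :=
    (Complex.le_def.mp (hpsd.dotProduct_mulVec_nonneg fun i : S => v i)).1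
  have h3 : quad (Matrix.diagonal (fun _ : S => (b : ℂ)) - B) (fun i : S => v i) =
      b * ∑ i, Complex.normSq (v i) - quad A v := by
    have e1 : ∑ i, Complex.normSq (v i) = ∑ i : S, Complex.normSq (v i) := by
      rw [Finset.univ_eq_attach, Finset.sum_attach S fun i => Complex.normSq (v i)]
      exact (Finset.sum_subset (Finset.subset_univ S) fun i _ hi => h1 i hi).symm
    have e2 : quad A v = ∑ i : S, ∑ j : S, (conj (v i) * A i j * v j).re := by
      rw [quad_eq_sum, Finset.univ_eq_attach,
        Finset.sum_attach S fun i => ∑ j ∈ S.attach, (conj (v i) * A i j * v j).re]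
      rw [← Finset.sum_subset (Finset.subset_univ S) fun i _ hi => by simp [hv i hi]]
      refine Finset.sum_congr rfl fun i _ => ?_
      rw [Finset.sum_attach S fun j => (conj (v i) * A i j * v j).re]
      exact (Finset.sum_subset (Finset.subset_univ S) fun j _ hj => by simp [hv j hj]).symm
    rw [quad_eq_sum, e1, e2, Finset.mul_sum, ← Finset.sum_sub_distrib]
    refine Finset.sum_congr rfl fun i _ => ?_
    have e3 : ∀ j : S, (conj (v i) * (Matrix.diagonal (fun _ : S => (b : ℂ)) - B) i j * v j).re =
        (if i = j then b * Complex.normSq (v i) else 0) - (conj (v i) * A i j * v j).re := by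
      intro j
      rw [Matrix.sub_apply, Matrix.diagonal_apply, hB, Matrix.submatrix_apply, mul_sub, sub_mul,
        Complex.sub_re]
      congr 1
      by_cases hij : i = j
      · subst hij
        simp [Complex.normSq_apply]
        ring
      · simp [hij]
    simp only [e3, Finset.sum_sub_distrib, Finset.sum_ite_eq, Finset.mem_univ, if_true]
  linarith

/-- One-sided paving of Hermitian matrices with zero diagonal. -/
theorem exists_paving [Nonempty κ] (hA : A.IsHermitian) (hdiag : ∀ j, A j j = 0) {a b s : ℝ}
    (ha : 0 < a) (hb : 0 < b) (hs : 0 < s)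
    (hlow : ∀ v, -(a * ∑ i, Complex.normSq (v i)) ≤ quad A v)
    (hupp : ∀ v, quad A v ≤ b * ∑ i, Complex.normSq (v i)) :
    ∃ c : ι → κ, ∀ (k : κ) (v : ι → ℂ), (∀ i, c i ≠ k → v i = 0) →
      quad A v ≤ (a * b / s + 2 * (s + b) / Fintype.card κ) * ∑ i, Complex.normSq (v i) := by
  set r : ℝ := (Fintype.card κ : ℝ) with hr
  have hr0 : 0 < r := by rw [hr]; exact_mod_cast (Fintype.card_pos : 0 < Fintype.card κ)
  set m := s * (s + a + b) / (s + a) with hm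
  have hm0 : 0 < m := by positivity
  -- The barrier starts at `b + s`. Since `b + s - m = ab / (s + a)`, `m ≤ s + b` and `(1 - 1/r)² ≥
  -- 1 - 2/r`, this is at most the required bound.
  set β := b + s - (1 - 1 / r) ^ 2 * m with hβ
  have hpos : ∀ x, β ≤ x → 0 < mixedR A Finset.univ.toList (fun _ : κ => ∅) fun _ => x := by
    intro x hx
    exact mixedR_pos_of_quadratic hA hm0 (normSq_le_of_quad_bounds hA hdiag ha hb hs hlow hupp)
      (Finset.nodup_toList _) (by simp) fun _ => hx
  obtain ⟨S, -, h2, h3⟩ := exists_mixedR_nil_pos hA (Finset.nodup_toList _) (by simp) hpos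
  choose c hc using fun i => h2 i (by simp)
  refine ⟨c, fun k v hv => ?_⟩
  have h4 : ∀ i ∉ S k, v i = 0 := by
    intro i hi
    refine hv i ?_
    rintro rfl
    exact hi (hc i)
  refine (quad_le_of_minor_ne_zero hA (b := β) (S := S k) (fun x hx h0 => ?_) h4).trans ?_
  · have := h3 x hx
    rw [mixedR_nil_const hA, Finset.prod_eq_zero (Finset.mem_univ k) (by simp [h0])] at this
    exact lt_irrefl _ this
  · refine mul_le_mul_of_nonneg_right ?_ (Finset.sum_nonneg fun i _ => Complex.normSq_nonneg _)
    have e1 : b + s - m = a * b / (s + a) := by rw [hm]; field_simp; ring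
    have e2 : m ≤ s + b := by
      have : 0 ≤ a * b / (s + a) := by positivity
      linarith
    have e3 : a * b / (s + a) ≤ a * b / s := by gcongr; linarith
    have e4 : 2 * (s + b) / r = 2 / r * (s + b) := by ring
    have e5 : 2 / r * m ≤ 2 / r * (s + b) := by gcongr
    have e6 : (1 - 2 / r) * m ≤ (1 - 1 / r) ^ 2 * m := by
      gcongr
      have : (1 - 1 / r) ^ 2 - (1 - 2 / r) = (1 / r) ^ 2 := by ring
      have := sq_nonneg (1 / r)
      linarith
    rw [hβ, e4]
    linarith

/-- A positive semidefinite matrix with unit diagonal can be paved so that every block is close to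
the identity. -/
theorem exists_paving_gram {κ₁ κ₂ : Type*} [Fintype κ₁] [Fintype κ₂] {G : Matrix ι ι ℂ}
    (hG : G.IsHermitian) (hdiag : ∀ j, G j j = 1) {B ε : ℝ} (hB : 1 ≤ B) (hε0 : 0 < ε) (hε1 : ε < 1)
    (hlow : ∀ v, 0 ≤ quad G v) (hupp : ∀ v, quad G v ≤ B * ∑ i, Complex.normSq (v i))
    (h₁ : 40 * B / ε ^ 2 ≤ Fintype.card κ₁) (h₂ : 40 / ε ≤ Fintype.card κ₂) :
    ∃ c : ι → κ₁ × κ₂, ∀ (k : κ₁ × κ₂) (v : ι → ℂ), (∀ i, c i ≠ k → v i = 0) →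
      (1 - ε) * ∑ i, Complex.normSq (v i) ≤ quad G v ∧
        quad G v ≤ (1 + ε) * ∑ i, Complex.normSq (v i) := by
  classical
  have hq : ∀ v : ι → ℂ, 0 ≤ ∑ i, Complex.normSq (v i) := fun v =>
    Finset.sum_nonneg fun i _ => Complex.normSq_nonneg _
  have hc1 : (0 : ℝ) < Fintype.card κ₁ := lt_of_lt_of_le (by positivity) h₁
  have hc2 : (0 : ℝ) < Fintype.card κ₂ := lt_of_lt_of_le (by positivity) h₂
  have : Nonempty κ₁ := Fintype.card_pos_iff.mp (by exact_mod_cast hc1)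
  have : Nonempty κ₂ := Fintype.card_pos_iff.mp (by exact_mod_cast hc2)
  have hone : ∀ v : ι → ℂ, quad 1 v = ∑ i, Complex.normSq (v i) := by
    intro v
    simp only [quad, Matrix.one_mulVec, dotProduct, Complex.re_sum]
    refine Finset.sum_congr rfl fun i _ => ?_
    simp [Complex.normSq_apply]
  have hsub : ∀ (M N : Matrix ι ι ℂ) (v : ι → ℂ), quad (M - N) v = quad M v - quad N v := by
    intro M N v
    simp only [quad, Matrix.sub_mulVec, dotProduct_sub, Complex.sub_re]
  obtain ⟨c₁, hc₁⟩ := exists_paving (κ := κ₁) (A := G - 1) (hG.sub Matrix.isHermitian_one)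
    (by simp [hdiag]) (a := 1) (b := B) (s := 4 * B / ε) one_pos (by linarith) (by positivity)
    (fun v => by rw [hsub, hone]; linarith [hlow v])
    (fun v => by rw [hsub, hone]; linarith [hupp v, hq v])
  -- With `s = 4B/ε` and `r ≥ 40B/ε²`, each of the two terms is at most `ε / 4`.
  have hb1 : 1 * B / (4 * B / ε) + 2 * (4 * B / ε + B) / Fintype.card κ₁ ≤ ε := by
    have e1 : 1 * B / (4 * B / ε) = ε / 4 := by field_simp
    have e2 : 2 * (4 * B / ε + B) / Fintype.card κ₁ ≤ ε / 4 := by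
      rw [div_le_iff₀ hc1]
      have e3 : 2 * (4 * B / ε + B) ≤ 10 * B / ε := by
        have : B ≤ B / ε := by rw [le_div_iff₀ hε0]; nlinarith
        have e4 : 4 * B / ε = 4 * (B / ε) := by ring
        have e5 : 10 * B / ε = 10 * (B / ε) := by ring
        rw [e4, e5]
        linarith
      have e4 : 10 * B / ε = ε / 4 * (40 * B / ε ^ 2) := by field_simp; ring
      rw [e4] at e3
      exact e3.trans (by gcongr)
    linarith
  have hup1 : ∀ (k : κ₁) (v : ι → ℂ), (∀ i, c₁ i ≠ k → v i = 0) →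
      quad G v ≤ (1 + ε) * ∑ i, Complex.normSq (v i) := by
    intro k v hv
    have h := (hc₁ k v hv).trans (mul_le_mul_of_nonneg_right hb1 (hq v))
    rw [hsub, hone] at h
    linarith
  -- Only the blocks of the first colouring are kept, so the upper bound `1 + ε` on each block
  -- becomes the lower bound `-ε` for all of `A`.
  set A : Matrix ι ι ℂ := Matrix.of fun i j => if c₁ i = c₁ j then (1 - G) i j else 0 with hA
  have hAH : A.IsHermitian := by
    ext i j
    have := (Matrix.isHermitian_one.sub hG).apply i j
    by_cases h : c₁ i = c₁ j
    · simpa [hA, h, Matrix.conjTranspose_apply] using this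
    · have h' : c₁ j ≠ c₁ i := Ne.symm h
      simp [hA, h, h', Matrix.conjTranspose_apply]
  set res : κ₁ → (ι → ℂ) → ι → ℂ := fun k v i => if c₁ i = k then v i else 0 with hres
  have hquadA : ∀ v, quad A v = ∑ k, (∑ i, Complex.normSq (res k v i) - quad G (res k v)) := by
    intro v
    have e1 : ∀ k, ∑ i, Complex.normSq (res k v i) - quad G (res k v) =
        ∑ i, ∑ j, (conj (res k v i) * (1 - G) i j * res k v j).re := by
      intro k
      rw [← hone, ← hsub, quad_eq_sum]
    simp only [e1]
    rw [quad_eq_sum]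
    symm
    rw [Finset.sum_comm]
    refine Finset.sum_congr rfl fun i _ => ?_
    rw [Finset.sum_comm]
    refine Finset.sum_congr rfl fun j _ => ?_
    rw [Finset.sum_eq_single (c₁ i)]
    · by_cases h : c₁ i = c₁ j
      · simp [hA, hres, h]
      · have h' : c₁ j ≠ c₁ i := Ne.symm h
        simp [hA, hres, h, h']
    · intro k _ hk
      simp [hres, Ne.symm hk]
    · simp
  have hsplit : ∀ v : ι → ℂ, ∑ i, Complex.normSq (v i) =
      ∑ k, ∑ i, Complex.normSq (res k v i) := by
    intro v
    rw [Finset.sum_comm]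
    refine Finset.sum_congr rfl fun i _ => ?_
    rw [Finset.sum_eq_single (c₁ i)]
    · simp [hres]
    · intro k _ hk
      simp [hres, Ne.symm hk]
    · simp
  obtain ⟨c₂, hc₂⟩ := exists_paving (κ := κ₂) hAH (by simp [hA, hdiag]) (a := ε) (b := 1) (s := 4)
    hε0 one_pos (by norm_num)
    (fun v => by
      rw [hquadA, hsplit, Finset.mul_sum, ← Finset.sum_neg_distrib]
      refine Finset.sum_le_sum fun k _ => ?_
      have := hup1 k (res k v) fun i hi => by simp [hres, hi]
      linarith)
    (fun v => by
      rw [hquadA, hsplit, Finset.mul_sum]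
      refine Finset.sum_le_sum fun k _ => ?_
      linarith [hlow (res k v)])
  have hb2 : ε * 1 / 4 + 2 * (4 + 1) / Fintype.card κ₂ ≤ ε := by
    have e2 : 2 * (4 + 1) / (Fintype.card κ₂ : ℝ) ≤ ε / 4 := by
      rw [div_le_iff₀ hc2]
      have e4 : (2 : ℝ) * (4 + 1) = ε / 4 * (40 / ε) := by field_simp; norm_num
      rw [e4]
      gcongr
    linarith
  refine ⟨fun i => (c₁ i, c₂ i), fun k v hv => ?_⟩
  have hv1 : ∀ i, c₁ i ≠ k.1 → v i = 0 := fun i hi => hv i fun h => hi (congrArg Prod.fst h)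
  have hv2 : ∀ i, c₂ i ≠ k.2 → v i = 0 := fun i hi => hv i fun h => hi (congrArg Prod.snd h)
  refine ⟨?_, hup1 k.1 v hv1⟩
  have h := (hc₂ k.2 v hv2).trans (mul_le_mul_of_nonneg_right hb2 (hq v))
  have e1 : quad A v = quad (1 - G) v := by
    rw [quad_eq_sum, quad_eq_sum]
    refine Finset.sum_congr rfl fun i _ => Finset.sum_congr rfl fun j _ => ?_
    by_cases h : c₁ i = c₁ j
    · simp [hA, h]
    · by_cases hi : c₁ i = k.1
      · have : v j = 0 := hv1 j fun hj => h (hi.trans hj.symm)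
        simp [this]
      · simp [hv1 i hi]
  rw [e1, hsub, hone] at h
  linarith

/-! ### Riesz sequences -/

/-- The canonical embedding of `𝕜` into `ℂ`. -/
noncomputable def toComplexHom (𝕜 : Type*) [RCLike 𝕜] : 𝕜 →+* ℂ where
  toFun a := ⟨RCLike.re a, RCLike.im a⟩
  map_one' := by apply Complex.ext <;> simp
  map_mul' a b := by apply Complex.ext <;> simp
  map_zero' := by apply Complex.ext <;> simp
  map_add' a b := by apply Complex.ext <;> simp

section
variable {𝕜 : Type*} [RCLike 𝕜]

theorem toComplexHom_re (a : 𝕜) : (toComplexHom 𝕜 a).re = RCLike.re a := rfl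

theorem toComplexHom_conj (a : 𝕜) : toComplexHom 𝕜 (conj a) = conj (toComplexHom 𝕜 a) := by
  apply Complex.ext <;> simp [toComplexHom]

theorem normSq_toComplexHom (a : 𝕜) : Complex.normSq (toComplexHom 𝕜 a) = ‖a‖ ^ 2 := by
  rw [← RCLike.normSq_eq_def', RCLike.normSq_apply, Complex.normSq_apply]
  rfl

-- A factorisation `R* R` survives the embedding into `ℂ`, so real scalars reduce to complex ones
-- without losing positivity against complex vectors.
open scoped ComplexOrder MatrixOrder in
theorem quad_map_nonneg {ι : Type*} [Fintype ι] [DecidableEq ι] {M : Matrix ι ι 𝕜}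
    (hM : M.PosSemidef) (v : ι → ℂ) : 0 ≤ quad (M.map (toComplexHom 𝕜)) v := by
  obtain ⟨R, rfl⟩ := CStarAlgebra.nonneg_iff_eq_star_mul_self.mp hM.nonneg
  rw [Matrix.star_eq_conjTranspose]
  have h : (R.conjTranspose * R).map (toComplexHom 𝕜) =
      (R.map (toComplexHom 𝕜)).conjTranspose * R.map (toComplexHom 𝕜) := by
    rw [Matrix.map_mul]
    congr 1
    ext i j
    simp only [Matrix.map_apply, Matrix.conjTranspose_apply]
    exact toComplexHom_conj _
  rw [h]
  exact (Complex.le_def.mp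
    ((Matrix.posSemidef_conjTranspose_mul_self _).dotProduct_mulVec_nonneg v)).1

variable {H : Type*} [NormedAddCommGroup H] [InnerProductSpace 𝕜 H] {I : Type*}

/-- Duality: expand `⟨x, x⟩` for `x = ∑ a i • u i` and apply Cauchy–Schwarz and the Bessel bound to
`x`. -/
theorem norm_sum_smul_sq_le {u : I → H} {B : ℝ} (hu : IsBesselSeq 𝕜 u B) (s : Finset I)
    (a : I → 𝕜) : ‖∑ i ∈ s, a i • u i‖ ^ 2 ≤ B * ∑ i ∈ s, ‖a i‖ ^ 2 := by
  set x := ∑ i ∈ s, a i • u i with hx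
  have h1 : ‖x‖ ^ 2 ≤ ∑ i ∈ s, ‖a i‖ * ‖inner 𝕜 x (u i)‖ := by
    have : (‖x‖ ^ 2 : ℝ) = ‖inner 𝕜 x x‖ := by
      rw [inner_self_eq_norm_sq_to_K, norm_pow, RCLike.norm_ofReal, abs_norm]
    rw [this]
    conv_lhs => rw [hx, inner_sum]
    refine (norm_sum_le _ _).trans (Finset.sum_le_sum fun i _ => ?_)
    rw [inner_smul_right, norm_mul]
  have h2 := Finset.sum_mul_sq_le_sq_mul_sq s (fun i => ‖a i‖) (fun i => ‖inner 𝕜 x (u i)‖)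
  have h3 : ∑ i ∈ s, ‖inner 𝕜 x (u i)‖ ^ 2 ≤ B * ‖x‖ ^ 2 :=
    ((hu.2 x).1.sum_le_tsum s fun i _ => by positivity).trans (hu.2 x).2
  have h4 : 0 ≤ ∑ i ∈ s, ‖a i‖ ^ 2 := Finset.sum_nonneg fun i _ => by positivity
  have h5 : (‖x‖ ^ 2) ^ 2 ≤ (∑ i ∈ s, ‖a i‖ ^ 2) * (B * ‖x‖ ^ 2) :=
    (pow_le_pow_left₀ (by positivity) h1 2).trans (h2.trans (by gcongr))
  by_cases h0 : ‖x‖ ^ 2 = 0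
  · rw [h0]; exact mul_nonneg hu.1.le h4
  · have : 0 < ‖x‖ ^ 2 := lt_of_le_of_ne (by positivity) (Ne.symm h0)
    nlinarith

theorem quad_gram {ι : Type*} [Fintype ι] [DecidableEq ι] (u : ι → H) (a : ι → 𝕜) :
    quad ((Matrix.gram 𝕜 u).map (toComplexHom 𝕜)) (fun i => toComplexHom 𝕜 (a i)) =
      ‖∑ i, a i • u i‖ ^ 2 := by
  rw [quad_eq_sum, ← inner_self_eq_norm_sq (𝕜 := 𝕜), sum_inner, map_sum]
  refine Finset.sum_congr rfl fun i _ => ?_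
  rw [inner_sum, map_sum]
  refine Finset.sum_congr rfl fun j _ => ?_
  rw [inner_smul_left, inner_smul_right, Matrix.map_apply, Matrix.gram_apply, ← toComplexHom_conj,
    ← map_mul, ← map_mul, toComplexHom_re]
  congr 1
  ring

open scoped ComplexOrder in
theorem exists_finite_coloring {u : I → H} {B : ℝ} (hunit : ∀ i, ‖u i‖ = 1)
    (hu : IsBesselSeq 𝕜 u B) (hB : 1 ≤ B) {ε : ℝ} (hε0 : 0 < ε) (hε1 : ε < 1)
    {κ₁ κ₂ : Type*} [Fintype κ₁] [Fintype κ₂] [Nonempty κ₁] [Nonempty κ₂]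
    (h₁ : 40 * B / ε ^ 2 ≤ Fintype.card κ₁) (h₂ : 40 / ε ≤ Fintype.card κ₂) (s : Finset I) :
    ∃ c : I → κ₁ × κ₂, ∀ k, ∀ t ⊆ s, (∀ i ∈ t, c i = k) → ∀ a : I → 𝕜,
      (1 - ε) * ∑ i ∈ t, ‖a i‖ ^ 2 ≤ ‖∑ i ∈ t, a i • u i‖ ^ 2 ∧
        ‖∑ i ∈ t, a i • u i‖ ^ 2 ≤ (1 + ε) * ∑ i ∈ t, ‖a i‖ ^ 2 := by
  classical
  set v : s → H := fun i => u i
  have hsub : ((B : 𝕜) • (1 : Matrix s s 𝕜) - Matrix.gram 𝕜 v).PosSemidef := by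
    refine .of_dotProduct_mulVec_nonneg ?_ fun a => ?_
    · refine Matrix.IsHermitian.sub ?_ (Matrix.isHermitian_gram 𝕜 v)
      ext i j
      by_cases h : i = j
      · subst h; simp [RCLike.real_smul_eq_coe_mul]
      · simp [h, Ne.symm h]
    · have h1 : ‖∑ i, a i • v i‖ ^ 2 ≤ B * ∑ i, ‖a i‖ ^ 2 := by
        have := norm_sum_smul_sq_le hu s fun i => if h : i ∈ s then a ⟨i, h⟩ else 0
        rw [← Finset.sum_attach, ← Finset.sum_attach s fun i => ‖_‖ ^ 2] at this
        simpa using this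
      have h2 : dotProduct (star a) a = ((∑ i, ‖a i‖ ^ 2 : ℝ) : 𝕜) := by
        push_cast
        exact Finset.sum_congr rfl fun i _ => RCLike.conj_mul _
      rw [Matrix.sub_mulVec, dotProduct_sub, Matrix.star_dotProduct_gram_mulVec,
        inner_self_eq_norm_sq_to_K, Matrix.smul_mulVec, Matrix.one_mulVec, dotProduct_smul, h2,
        smul_eq_mul]
      have h3 : (0 : 𝕜) ≤ ((B * ∑ i, ‖a i‖ ^ 2 - ‖∑ i, a i • v i‖ ^ 2 : ℝ) : 𝕜) :=
        RCLike.ofReal_nonneg.mpr (sub_nonneg.mpr h1)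
      push_cast at h3 ⊢
      exact h3
  set G := (Matrix.gram 𝕜 v).map (toComplexHom 𝕜) with hG
  have hGH : G.IsHermitian := by
    ext i j
    rw [Matrix.conjTranspose_apply, hG, Matrix.map_apply, Matrix.map_apply, Matrix.gram_apply,
      Matrix.gram_apply, ← inner_conj_symm (𝕜 := 𝕜) (v i) (v j), toComplexHom_conj]
    rfl
  obtain ⟨c, hc⟩ := exists_paving_gram (κ₁ := κ₁) (κ₂ := κ₂) hGH (fun j => by
      rw [hG, Matrix.map_apply, Matrix.gram_apply, inner_self_eq_norm_sq_to_K, hunit]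
      simp) hB hε0 hε1 (quad_map_nonneg (Matrix.posSemidef_gram 𝕜 v)) (fun w => by
      have h1 := quad_map_nonneg hsub w
      have h2 : quad (((B : 𝕜) • (1 : Matrix s s 𝕜) - Matrix.gram 𝕜 v).map (toComplexHom 𝕜)) w =
          B * ∑ i, Complex.normSq (w i) - quad G w := by
        rw [quad_eq_sum, quad_eq_sum, Finset.mul_sum, ← Finset.sum_sub_distrib]
        refine Finset.sum_congr rfl fun i _ => ?_
        have h3 : ∀ j, (conj (w i) * (((B : 𝕜) • (1 : Matrix s s 𝕜) - Matrix.gram 𝕜 v).map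
            (toComplexHom 𝕜)) i j * w j).re =
            (if i = j then B * Complex.normSq (w i) else 0) - (conj (w i) * G i j * w j).re := by
          intro j
          rw [Matrix.map_apply, Matrix.sub_apply, map_sub, mul_sub, sub_mul, Complex.sub_re]
          congr 1
          by_cases hij : i = j
          · subst hij
            have h4 : toComplexHom 𝕜 (B : 𝕜) = (B : ℂ) := by
              apply Complex.ext <;> simp [toComplexHom]
            simp [Complex.normSq_apply, h4]
            ring
          · simp [hij]
        simp only [h3, Finset.sum_sub_distrib, Finset.sum_ite_eq, Finset.mem_univ, if_true]
      linarith) h₁ h₂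
  refine ⟨fun i => if h : i ∈ s then c ⟨i, h⟩ else Classical.arbitrary _, fun k t hts hck a => ?_⟩
  have h1 := hc k (fun i => toComplexHom 𝕜 (if (i : I) ∈ t then a i else 0)) fun i hi => by
    rw [if_neg, map_zero]
    intro hit
    have := hck i hit
    simp only [i.2, dif_pos] at this
    exact hi this
  rw [hG, quad_gram] at h1
  have e1 : ∑ i : s, Complex.normSq (toComplexHom 𝕜 (if (i : I) ∈ t then a i else 0)) =
      ∑ i ∈ t, ‖a i‖ ^ 2 := by
    simp only [normSq_toComplexHom]
    rw [Finset.univ_eq_attach, Finset.sum_attach s fun i => ‖if i ∈ t then a i else 0‖ ^ 2,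
      ← Finset.sum_subset hts fun i _ hi => by simp [hi]]
    exact Finset.sum_congr rfl fun i hi => by simp [hi]
  have e2 : ∑ i : s, (if (i : I) ∈ t then a i else 0) • v i = ∑ i ∈ t, a i • u i := by
    rw [Finset.univ_eq_attach, Finset.sum_attach s fun i => (if i ∈ t then a i else 0) • u i,
      ← Finset.sum_subset hts fun i _ hi => by simp [hi]]
    exact Finset.sum_congr rfl fun i hi => by simp [hi]
  rwa [e1, e2] at h1

theorem exists_coloring {u : I → H} {B : ℝ} (hunit : ∀ i, ‖u i‖ = 1)
    (hu : IsBesselSeq 𝕜 u B) (hB : 1 ≤ B) {ε : ℝ} (hε0 : 0 < ε) (hε1 : ε < 1)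
    {κ₁ κ₂ : Type*} [Fintype κ₁] [Fintype κ₂] [Nonempty κ₁] [Nonempty κ₂]
    (h₁ : 40 * B / ε ^ 2 ≤ Fintype.card κ₁) (h₂ : 40 / ε ≤ Fintype.card κ₂) :
    ∃ c : I → κ₁ × κ₂, ∀ k, ∀ t : Finset I, (∀ i ∈ t, c i = k) → ∀ a : I → 𝕜,
      (1 - ε) * ∑ i ∈ t, ‖a i‖ ^ 2 ≤ ‖∑ i ∈ t, a i • u i‖ ^ 2 ∧
        ‖∑ i ∈ t, a i • u i‖ ^ 2 ≤ (1 + ε) * ∑ i ∈ t, ‖a i‖ ^ 2 := by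
  choose g hg using exists_finite_coloring hunit hu hB hε0 hε1 h₁ h₂
  obtain ⟨c, hc⟩ := Finset.rado_selection g
  refine ⟨c, fun k t htk a => ?_⟩
  obtain ⟨s, hts, hcs⟩ := hc t
  exact hg s k t hts (fun i hi => (hcs i hi).symm.trans (htk i hi)) a

/-- The upper bound makes the partial sums Cauchy over finite sets; both inequalities then pass to
the limit. -/
theorem isRieszSeq_of_finset {J : Type*} [CompleteSpace H] {u : J → H} {A B : ℝ} (hA : 0 < A)
    (hB : 0 < B)
    (h : ∀ (t : Finset J) (a : J → 𝕜), A * ∑ i ∈ t, ‖a i‖ ^ 2 ≤ ‖∑ i ∈ t, a i • u i‖ ^ 2 ∧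
      ‖∑ i ∈ t, a i • u i‖ ^ 2 ≤ B * ∑ i ∈ t, ‖a i‖ ^ 2) : IsRieszSeq 𝕜 u A B := by
  refine ⟨hA, hB, fun a ha => ?_⟩
  have hs : Summable fun i => a i • u i := by
    rw [summable_iff_vanishing_norm] at ha ⊢
    intro δ hδ
    obtain ⟨s, hs⟩ := ha (δ ^ 2 / B) (by positivity)
    refine ⟨s, fun t ht => ?_⟩
    have h1 := hs t ht
    rw [Real.norm_of_nonneg (Finset.sum_nonneg fun i _ => by positivity), lt_div_iff₀ hB] at h1
    refine lt_of_pow_lt_pow_left₀ 2 hδ.le ?_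
    have := (h t a).2
    linarith
  have h1 : Filter.Tendsto (fun t : Finset J => ‖∑ i ∈ t, a i • u i‖ ^ 2) Filter.atTop
      (nhds (‖∑' i, a i • u i‖ ^ 2)) := (Filter.Tendsto.norm hs.hasSum).pow 2
  have h2 : Filter.Tendsto (fun t : Finset J => ∑ i ∈ t, ‖a i‖ ^ 2) Filter.atTop
      (nhds (∑' i, ‖a i‖ ^ 2)) := ha.hasSum
  exact ⟨hs, le_of_tendsto_of_tendsto' (h2.const_mul A) h1 fun t => (h t a).1,
    le_of_tendsto_of_tendsto' h1 (h2.const_mul B) fun t => (h t a).2⟩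

theorem isRieszSeq_subtype_of_finset [CompleteSpace H] {u : I → H} {S : Set I} {A B : ℝ}
    (hA : 0 < A) (hB : 0 < B)
    (h : ∀ t : Finset I, (∀ i ∈ t, i ∈ S) → ∀ a : I → 𝕜,
      A * ∑ i ∈ t, ‖a i‖ ^ 2 ≤ ‖∑ i ∈ t, a i • u i‖ ^ 2 ∧
      ‖∑ i ∈ t, a i • u i‖ ^ 2 ≤ B * ∑ i ∈ t, ‖a i‖ ^ 2) :
    IsRieszSeq 𝕜 (fun i : S => u i) A B := by
  refine isRieszSeq_of_finset hA hB fun t a => ?_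
  have h1 := h (t.map (Function.Embedding.subtype (· ∈ S))) (fun i hi => by
    obtain ⟨i', -, rfl⟩ := Finset.mem_map.mp hi
    exact i'.2) (Function.extend Subtype.val a 0)
  simpa only [Finset.sum_map, Function.Embedding.subtype_apply,
    Subtype.val_injective.extend_apply] using h1

end

end Paving

/-! ### The theorem -/

theorem mainTheorem8 :
    ∃ C : ℝ, 0 < C ∧
      ∀ (𝕜 : Type*) [RCLike 𝕜]
        (H : Type*) [NormedAddCommGroup H] [InnerProductSpace 𝕜 H] [CompleteSpace H]
        [TopologicalSpace.SeparableSpace H]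
        (I : Type*) (u : I → H) (B : ℝ),
        (∀ i, ‖u i‖ = 1) → IsBesselSeq 𝕜 u B →
        ∀ ε : ℝ, 0 < ε → ε < 1 →
          ∃ (r : ℕ) (S : Fin r → Set I),
            (r : ℝ) ≤ C * (B / ε ^ 4) ∧
            (∀ j, (S j).Nonempty) ∧
            Pairwise (fun j k => Disjoint (S j) (S k)) ∧
            (⋃ j, S j) = Set.univ ∧
            ∀ j, IsRieszSeq 𝕜 (fun i : S j => u i) (1 - ε) (1 + ε) := by
  classical
  refine ⟨1681, by norm_num, ?_⟩
  intro 𝕜 _ H _ _ _ _ I u B hunit hu ε hε0 hε1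
  rcases isEmpty_or_nonempty I with hI | ⟨⟨i₀⟩⟩
  · refine ⟨0, Fin.elim0, ?_, fun j => j.elim0, fun j => j.elim0, ?_, fun j => j.elim0⟩
    · have := hu.1
      simp only [Nat.cast_zero]
      positivity
    · exact Set.eq_univ_of_forall fun i => hI.elim i
  -- Test the Bessel inequality on one of the unit vectors.
  have hB : 1 ≤ B := by
    obtain ⟨h1, h2⟩ := hu.2 (u i₀)
    have h3 := h1.le_tsum i₀ fun j _ => by positivity
    have h4 : ‖inner 𝕜 (u i₀) (u i₀)‖ = 1 := by
      rw [inner_self_eq_norm_sq_to_K, hunit]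
      simp
    rw [h4] at h3
    rw [hunit] at h2
    linarith
  set r₁ := ⌈40 * B / ε ^ 2⌉₊ with hr₁
  set r₂ := ⌈40 / ε⌉₊ with hr₂
  have hr₁0 : 0 < r₁ := Nat.ceil_pos.mpr (by positivity)
  have hr₂0 : 0 < r₂ := Nat.ceil_pos.mpr (by positivity)
  have : Nonempty (Fin r₁) := ⟨⟨0, hr₁0⟩⟩
  have : Nonempty (Fin r₂) := ⟨⟨0, hr₂0⟩⟩
  obtain ⟨c, hc⟩ := Paving.exists_coloring (κ₁ := Fin r₁) (κ₂ := Fin r₂) hunit hu hB hε0 hε1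
    (by rw [Fintype.card_fin]; exact Nat.le_ceil _) (by rw [Fintype.card_fin]; exact Nat.le_ceil _)
  set e := Fintype.equivFin (Set.range c)
  refine ⟨Fintype.card (Set.range c), fun j => {i | c i = (e.symm j : Fin r₁ × Fin r₂)}, ?_,
    fun j => ?_, fun j k hjk => ?_, ?_, fun j => ?_⟩
  · have h1 : Fintype.card (Set.range c) ≤ r₁ * r₂ := by
      refine (Fintype.card_subtype_le _).trans ?_
      simp
    have h2 : (r₁ : ℝ) ≤ 41 * (B / ε ^ 2) := by
      have h3 : 1 ≤ B / ε ^ 2 := by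
        rw [le_div_iff₀ (by positivity)]
        nlinarith
      have h4 := (Nat.ceil_lt_add_one (by positivity : 0 ≤ 40 * B / ε ^ 2)).le
      rw [← hr₁, mul_div_assoc] at h4
      linarith
    -- Here `r₂` is of order `1/ε`; the weaker `1/ε²` already yields the exponent 4. Each 41 is 40
    -- plus the rounding, and `1681 = 41²`.
    have h3 : (r₂ : ℝ) ≤ 41 * (1 / ε ^ 2) := by
      have h3 : 1 ≤ 1 / ε ^ 2 := by
        rw [le_div_iff₀ (by positivity)]
        nlinarith
      have h4 := (Nat.ceil_lt_add_one (by positivity : 0 ≤ 40 / ε)).le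
      have h5 : 40 / ε ≤ 40 * (1 / ε ^ 2) := by
        rw [mul_one_div]
        gcongr
        nlinarith
      rw [← hr₂] at h4
      linarith
    calc (Fintype.card (Set.range c) : ℝ) ≤ r₁ * r₂ := by exact_mod_cast h1
      _ ≤ 41 * (B / ε ^ 2) * (41 * (1 / ε ^ 2)) := by gcongr
      _ = 1681 * (B / ε ^ 4) := by field_simp; norm_num
  · obtain ⟨i, hi⟩ := (e.symm j).2
    exact ⟨i, hi⟩
  · refine Set.disjoint_left.mpr fun i (hi : c i = _) (hi' : c i = _) => ?_
    exact hjk (e.symm.injective (Subtype.ext (hi.symm.trans hi')))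
  · refine Set.eq_univ_of_forall fun i => Set.mem_iUnion.mpr ⟨e ⟨c i, i, rfl⟩, ?_⟩
    simp
  · exact Paving.isRieszSeq_subtype_of_finset (by linarith) (by linarith) fun t ht a =>
      hc (e.symm j) t ht a
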